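/- Let $S, A \ge 1$ be the numbers of states and actions, let $\lambda\in(0,1)$, $\kappa>0$, let $r_{sas'}\ge 0$ be rewards and let $\overline{\boldsymbol p}_{sa}\in\Delta_S$ be nominal transition probabilities ($s,s'\in\{1,\dots,S\}$, $a\in\{1,\dots,A\}$), where $\Delta_n$ is the probability simplex in $\mathbb R^n$. For the Burg entropy $\phi(t)=-\log t+t-1$ (with $\phi(0)=+\infty$) put $d(\boldsymbol p,\boldsymbol q)=\sum_{s'} q_{s'}\,\phi(p_{s'}/q_{s'})$, where a summand with $q_{s'}=0$ means $p_{s'}$ (so that $d(\boldsymbol p,\boldsymbol q)=\sum_{s'}q_{s'}\log (q_{s'}/p_{s'})$ on $\Delta_S$), and let $$\mathcal P_s=\Big\{\boldsymbol p_s\in(\Delta_S)^A:\ \sum_{a} d(\boldsymbol p_{sa},\overline{\boldsymbol p}_{sa})\le\kappa\Big\},\qquad [\mathfrak J(\boldsymbol v)]_s=\max_{\boldsymbol\pi_s\in\Delta_A}\ \min_{\boldsymbol p_s\in\mathcal P_s}\ \sum_{a}\pi_{sa}\,\boldsymbol p_{sa}^\top(\boldsymbol r_{sa}+\lambda\boldsymbol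 v).$$ Put $\overline R=(1-\lambda)^{-1}\max_{s,a,s'} r_{sas'}$. Let $\boldsymbol v\in\mathbb R^S$ be a value estimate with $v_s\le\overline R$ for all $s$ and $r_{sas'}+\lambda v_{s'}\ge 0$ for all $s,a,s'$ (for instance, any $\boldsymbol v$ between $\boldsymbol 0$ and the optimal robust value function). Time is counted on a real random access machine: memory consists of index registers (natural numbers), real registers and three-dimensional real arrays; additions and comparisons of indices, the operations $+,-,\cdot,/$, $\log$ and comparisons on real numbers, conversions of indices to reals, register and array accesses, assignments and branching decisions each take one unit of time. There are a single program of this machine and an absolute constant $C>0$ such that for all $S$, $A$, $\overline{\boldsymbol p}$, $\boldsymbol r$, $\lambda$, $\kappa$, $\boldsymbol v$ as above and every $\epsilon>0$, the program, given these data as input, halts with an output $\boldsymbol v'\in\mathbb R^S$ satisfying $\lVert\boldsymbol v'-\mathfrak J(\boldsymbol v)\rVert_\infty\le\epsilon$ after at most $$C\cdot S^2\cdot A\,\ell(A)\cdot \ell\!\left(\frac{\overline R^2}{\epsilon^2\kappa}\right)\cdot \ell\!\left(\frac{\overline R}{\epsilon}\right),\qquad \ell(x)=\max\{1,\log x\}\quad(\ell(0)=1),$$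 units of time. -/

import Mathlib

open scoped ENNReal

/-! ## Robust Bellman operator over an `s`-rectangular Burg entropy ambiguity set -/

namespace BurgRMDP

noncomputable section

/-- The Burg entropy generator `φ(t) = -log t + t - 1` on `[0, ∞)`, with `φ(0) = +∞`. -/
def burgPhi (t : ℝ) : ℝ≥0∞ :=
  if 0 < t then ENNReal.ofReal (-Real.log t + t - 1) else ⊤

/-- The summand `q * φ(x / q)` of the divergence, for `q, x ≥ 0`. For `q = 0` it has the usual
value `x * lim_{t → ∞} φ(t) / t`, and this limit is `1`. -/
def burgTerm (q x : ℝ) : ℝ≥0∞ :=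
  if q = 0 then ENNReal.ofReal x else ENNReal.ofReal q * burgPhi (x / q)

/-- The Burg entropy divergence `d(p, q) = ∑ s', q s' * φ(p s' / q s')`. -/
def burgDiv {S : ℕ} (p q : Fin S → ℝ) : ℝ≥0∞ :=
  ∑ s', burgTerm (q s') (p s')

/-- The ambiguity set `P_s`: all `p_s ∈ (Δ_S)^A` with `∑ a, d(p_sa, pbar_sa) ≤ κ`. -/
def ambiguitySet {S A : ℕ} (κ : ℝ) (pbar : Fin A → Fin S → ℝ) : Set (Fin A → Fin S → ℝ) :=
  {p | (∀ a, p a ∈ stdSimplex ℝ (Fin S)) ∧ ∑ a, burgDiv (p a) (pbar a) ≤ ENNReal.ofReal κ}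

/-- The data of a robust Bellman update: nominal transition probabilities `pbar s a s'`,
rewards `r s a s'`, discount factor `disc`, uncertainty budget `κ`, and the current estimate
`v` of the value function. -/
structure Data (S A : ℕ) where
  pbar : Fin S → Fin A → Fin S → ℝ
  r : Fin S → Fin A → Fin S → ℝ
  disc : ℝ
  κ : ℝ
  v : Fin S → ℝ

namespace Data

variable {S A : ℕ}

/-- The robust Bellman operator: `[J(v)]_s` is the maximum over `π_s ∈ Δ_A` of the minimum over
`p_s ∈ P_s` of `∑ a, π_sa * p_saᵀ (r_sa + disc * v)`. -/
def bellman (D : Data S A) (s : Fin S) : ℝ :=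
  ⨆ π : stdSimplex ℝ (Fin A), ⨅ p : ambiguitySet D.κ (D.pbar s),
    ∑ a, π.1 a * ∑ s', p.1 a s' * (D.r s a s' + D.disc * D.v s')

/-- `Rbar = (1 - disc)⁻¹ * max r`. -/
def Rbar (D : Data S A) : ℝ :=
  (1 - D.disc)⁻¹ * ⨆ i : Fin S × Fin A × Fin S, D.r i.1 i.2.1 i.2.2

/-- The admissible data. The last two conditions restrict the value estimate: `v` does not exceed
the upper bound `Rbar` on the optimal value function, and all vectors `r_sa + disc * v` are
nonnegative (as is the case for nonnegative `v`). -/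
structure Admissible (D : Data S A) : Prop where
  pbar_mem : ∀ s a, D.pbar s a ∈ stdSimplex ℝ (Fin S)
  r_nonneg : ∀ s a s', 0 ≤ D.r s a s'
  disc_pos : 0 < D.disc
  disc_lt_one : D.disc < 1
  κ_pos : 0 < D.κ
  v_le : ∀ s, D.v s ≤ D.Rbar
  b_nonneg : ∀ s a s', 0 ≤ D.r s a s' + D.disc * D.v s'

end Data

end

/-! ## The machine model: programs of a real random access machine with step count

Memory consists of index registers holding natural numbers, real registers, and real arrays whose
cells are addressed by triples of indices. Programs are finite, contain only natural number
constants, and do not depend on the input. Every register or array access, arithmetic operation,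
evaluation of the logarithm, comparison, assignment and branching decision takes one unit of
time. -/

/-- Index expressions. -/
inductive IExp : Type
  | const (n : ℕ)
  | var (x : ℕ)
  | add (e f : IExp)

/-- Real expressions. `ofIdx` converts an index to a real number, `arr n i j k` reads the cell
`(i, j, k)` of the array `n`. -/
inductive RExp : Type
  | ofIdx (e : IExp)
  | var (x : ℕ)
  | arr (n : ℕ) (i j k : IExp)
  | add (e f : RExp)
  | sub (e f : RExp)
  | mul (e f : RExp)
  | div (e f : RExp)
  | log (e : RExp)

/-- Tests: strict comparisons of indices and of reals, and Boolean combinations. -/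
inductive BExp : Type
  | ilt (e f : IExp)
  | rlt (e f : RExp)
  | not (b : BExp)
  | and (b c : BExp)

/-- Commands. -/
inductive Cmd : Type
  | skip
  | iset (x : ℕ) (e : IExp)
  | rset (x : ℕ) (e : RExp)
  | aset (n : ℕ) (i j k : IExp) (e : RExp)
  | seq (c d : Cmd)
  | ite (b : BExp) (c d : Cmd)
  | while (b : BExp) (c : Cmd)

/-- Memory contents. -/
structure State : Type where
  idx : ℕ → ℕ
  reg : ℕ → ℝ
  arr : ℕ → ℕ → ℕ → ℕ → ℝ

noncomputable section

def IExp.eval (σ : State) : IExp → ℕ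
  | .const n => n
  | .var x => σ.idx x
  | .add e f => e.eval σ + f.eval σ

def IExp.cost : IExp → ℕ
  | .const _ => 1
  | .var _ => 1
  | .add e f => e.cost + f.cost + 1

/-- Values of real expressions, in exact arithmetic. Division by zero returns `0` and the logarithm
of `x ≤ 0` returns `log |x|` (`0` for `x = 0`); the operations are total because a program can
test the arguments anyway. -/
def RExp.eval (σ : State) : RExp → ℝ
  | .ofIdx e => (e.eval σ : ℝ)
  | .var x => σ.reg x
  | .arr n i j k => σ.arr n (i.eval σ) (j.eval σ) (k.eval σ)
  | .add e f => e.eval σ + f.eval σ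
  | .sub e f => e.eval σ - f.eval σ
  | .mul e f => e.eval σ * f.eval σ
  | .div e f => e.eval σ / f.eval σ
  | .log e => Real.log (e.eval σ)

def RExp.cost : RExp → ℕ
  | .ofIdx e => e.cost + 1
  | .var _ => 1
  | .arr _ i j k => i.cost + j.cost + k.cost + 1
  | .add e f => e.cost + f.cost + 1
  | .sub e f => e.cost + f.cost + 1
  | .mul e f => e.cost + f.cost + 1
  | .div e f => e.cost + f.cost + 1
  | .log e => e.cost + 1

def BExp.holds (σ : State) : BExp → Prop
  | .ilt e f => e.eval σ < f.eval σ
  | .rlt e f => e.eval σ < f.eval σ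
  | .not b => ¬ b.holds σ
  | .and b c => b.holds σ ∧ c.holds σ

def BExp.cost : BExp → ℕ
  | .ilt e f => e.cost + f.cost + 1
  | .rlt e f => e.cost + f.cost + 1
  | .not b => b.cost + 1
  | .and b c => b.cost + c.cost + 1

def State.setIdx (σ : State) (x n : ℕ) : State :=
  { σ with idx := fun y => if y = x then n else σ.idx y }

def State.setReg (σ : State) (x : ℕ) (t : ℝ) : State :=
  { σ with reg := fun y => if y = x then t else σ.reg y }

def State.setArr (σ : State) (n i j k : ℕ) (t : ℝ) : State :=
  { σ with arr := fun n' i' j' k' =>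
      if n' = n ∧ i' = i ∧ j' = j ∧ k' = k then t else σ.arr n' i' j' k' }

/-- `Exec c σ τ t`: started in the memory `σ`, the command `c` halts with the memory `τ` after `t`
units of time. -/
inductive Exec : Cmd → State → State → ℕ → Prop
  | skip (σ : State) : Exec .skip σ σ 1
  | iset (x : ℕ) (e : IExp) (σ : State) :
      Exec (.iset x e) σ (σ.setIdx x (e.eval σ)) (e.cost + 1)
  | rset (x : ℕ) (e : RExp) (σ : State) :
      Exec (.rset x e) σ (σ.setReg x (e.eval σ)) (e.cost + 1)
  | aset (n : ℕ) (i j k : IExp) (e : RExp) (σ : State) :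
      Exec (.aset n i j k e) σ (σ.setArr n (i.eval σ) (j.eval σ) (k.eval σ) (e.eval σ))
        (i.cost + j.cost + k.cost + e.cost + 1)
  | seq {c d : Cmd} {σ τ ρ : State} {t u : ℕ} :
      Exec c σ τ t → Exec d τ ρ u → Exec (.seq c d) σ ρ (t + u)
  | iteTrue {b : BExp} {c d : Cmd} {σ τ : State} {t : ℕ} :
      b.holds σ → Exec c σ τ t → Exec (.ite b c d) σ τ (b.cost + 1 + t)
  | iteFalse {b : BExp} {c d : Cmd} {σ τ : State} {t : ℕ} :
      ¬ b.holds σ → Exec d σ τ t → Exec (.ite b c d) σ τ (b.cost + 1 + t)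
  | whileFalse {b : BExp} {c : Cmd} {σ : State} :
      ¬ b.holds σ → Exec (.while b c) σ σ (b.cost + 1)
  | whileTrue {b : BExp} {c : Cmd} {σ τ ρ : State} {t u : ℕ} :
      b.holds σ → Exec c σ τ t → Exec (.while b c) τ ρ u →
        Exec (.while b c) σ ρ (b.cost + 1 + t + u)

/-- The machine is deterministic: the final memory and the running time are unique. -/
theorem Exec.deterministic {c : Cmd} {σ τ τ' : State} {t t' : ℕ}
    (h : Exec c σ τ t) (h' : Exec c σ τ' t') : τ = τ' ∧ t = t' := by
  induction h generalizing τ' t' with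
  | skip | iset | rset | aset => cases h'; exact ⟨rfl, rfl⟩
  | seq _ _ ih₁ ih₂ =>
    cases h' with
    | seq k₁ k₂ =>
      obtain ⟨rfl, rfl⟩ := ih₁ k₁
      obtain ⟨rfl, rfl⟩ := ih₂ k₂
      exact ⟨rfl, rfl⟩
  | iteTrue hb _ ih =>
    cases h' with
    | iteTrue _ k => obtain ⟨rfl, rfl⟩ := ih k; exact ⟨rfl, rfl⟩
    | iteFalse hb' _ => exact absurd hb hb'
  | iteFalse hb _ ih =>
    cases h' with
    | iteTrue hb' _ => exact absurd hb' hb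
    | iteFalse _ k => obtain ⟨rfl, rfl⟩ := ih k; exact ⟨rfl, rfl⟩
  | whileFalse hb =>
    cases h' with
    | whileFalse => exact ⟨rfl, rfl⟩
    | whileTrue hb' _ _ => exact absurd hb' hb
  | whileTrue hb _ _ ih₁ ih₂ =>
    cases h' with
    | whileFalse hb' => exact absurd hb hb'
    | whileTrue _ k₁ k₂ =>
      obtain ⟨rfl, rfl⟩ := ih₁ k₁
      obtain ⟨rfl, rfl⟩ := ih₂ k₂
      exact ⟨rfl, rfl⟩

/-- The memory `σ` contains the data `D` and the accuracy `ε` in the input locations: the sizes in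
the index registers `0, 1`, the scalars in the real registers `0, 1, 2`, and `pbar`, `r`, `v` in the
arrays `0, 1, 2`. The rest of the memory is arbitrary. -/
structure Holds {S A : ℕ} (σ : State) (D : Data S A) (ε : ℝ) : Prop where
  size_S : σ.idx 0 = S
  size_A : σ.idx 1 = A
  disc : σ.reg 0 = D.disc
  κ : σ.reg 1 = D.κ
  ε : σ.reg 2 = ε
  pbar : ∀ (s : Fin S) (a : Fin A) (s' : Fin S), σ.arr 0 s a s' = D.pbar s a s'
  r : ∀ (s : Fin S) (a : Fin A) (s' : Fin S), σ.arr 1 s a s' = D.r s a s'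
  v : ∀ s : Fin S, σ.arr 2 s 0 0 = D.v s

/-- The vector of length `S` that the memory contains in the output location, array `3`. -/
def State.output (σ : State) (S : ℕ) : Fin S → ℝ :=
  fun s => σ.arr 3 s 0 0

/-- A logarithmic factor in a complexity bound: `max {1, log x}`. -/
def logFactor (x : ℝ) : ℝ :=
  max 1 (Real.log x)

end

end BurgRMDP

namespace BurgRMDP

/-! ### Lower and upper estimates for the Burg divergence -/

/-! Write b_a = r_sa + λv, q_a for the nominal distribution, R for `Rbar` and J for the robust value
at a fixed state. J is located by bisection in θ. Heuristically, J ≤ θ means that the projection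
costs min {d(p, q_a) : pᵀb_a ≤ θ} add up over a to at most κ. Each projection has the
one-dimensional concave dual: maximise ∑ q log(1 + α(b - θ)) over α ≥ 0. With bm = min b and α =
u/(θ - bm), 0 ≤ u < 1, its objective is `gain`, and it is solved by an inner bisection on the sign
of `slope`. Neither strong duality nor a minimax theorem is needed, because every approximate dual
solution settles the test one way or the other. If the gains add up to more than κ, the policy
proportional to α guarantees θ, by weak duality (`sum_mul_excess_nonneg`,
`Admissible.le_bellman_of_lt_gain`). Otherwise `exists_primal_of_slope` turns each nearly stationary
u into a distribution whose divergence is at most its gain and whose mean exceeds θ by at most ε, so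
J ≤ θ + ε (`Admissible.bellman_le_of_gain_le`). `neg_slope_le_of_bracket` shows that an inner
bracket of width ε²/(8R²) suffices. For the running time put x = R/ε. There are O(ℓ(x)) outer and
O(ℓ(x)) inner steps, and each inner step costs O(S) per action, giving S²A ℓ(x)². If κε ≥ AR, the
budget is so large that no bisection is needed (`Admissible.bellman_le_of_large_budget`). Otherwise
κ < Ax, so x < A x²/κ and one factor ℓ(x) is traded for ℓ(A) ℓ(x²/κ) (`logFactor_le_of_lt_mul`).
This trade is the only source of the factor ℓ(A). -/

lemma ofReal_le_burgTerm {q x w : ℝ} (hq : 0 ≤ q) (hx : 0 ≤ x) (hw : 0 < w) :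
    ENNReal.ofReal (q * Real.log w + x - x * w) ≤ burgTerm q x := by
  unfold burgTerm
  split_ifs with h
  · subst h
    apply ENNReal.ofReal_le_ofReal
    nlinarith [mul_nonneg hx hw.le]
  · have hq' : 0 < q := lt_of_le_of_ne hq (Ne.symm h)
    unfold burgPhi
    split_ifs with h1
    · rw [← ENNReal.ofReal_mul hq]
      apply ENNReal.ofReal_le_ofReal
      -- This is the Fenchel–Young inequality for φ, which here is log t ≤ t - 1 at t = (x/q) w.
      have h2 := Real.log_le_sub_one_of_pos (mul_pos h1 hw)
      rw [Real.log_mul h1.ne' hw.ne'] at h2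
      have h3 : q * (x / q) = x := by field_simp
      nlinarith [mul_le_mul_of_nonneg_left h2 hq]
    · rw [ENNReal.mul_top (by simpa using hq')]
      exact le_top

lemma ofReal_sum_le {ι : Type*} (s : Finset ι) (f : ι → ℝ) :
    ENNReal.ofReal (∑ i ∈ s, f i) ≤ ∑ i ∈ s, ENNReal.ofReal (f i) := by
  classical
  induction s using Finset.induction_on with
  | empty => simp
  | insert i s hi ih =>
    rw [Finset.sum_insert hi, Finset.sum_insert hi]
    exact ENNReal.ofReal_add_le.trans (add_le_add le_rfl ih)

/-- A density p/q bounded below by 1/w makes each -log(p/q) at most log w, and the linear parts p -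
q cancel in the sum over the simplex. Nonnegativity of the bound is recorded because such bounds are
later added inside `ENNReal.ofReal`. -/
lemma burgDiv_le_of_le_mul {S : ℕ} {p q w : Fin S → ℝ} (hp : p ∈ stdSimplex ℝ (Fin S))
    (hq : q ∈ stdSimplex ℝ (Fin S)) (hw : ∀ j, 0 < w j) (h : ∀ j, q j ≤ p j * w j) :
    0 ≤ ∑ j, q j * Real.log (w j) ∧
      burgDiv p q ≤ ENNReal.ofReal (∑ j, q j * Real.log (w j)) := by
  have key : ∀ j, 0 ≤ q j * Real.log (w j) + p j - q j ∧
      burgTerm (q j) (p j) ≤ ENNReal.ofReal (q j * Real.log (w j) + p j - q j) := by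
    intro j
    rcases (hq.1 j).eq_or_lt with h0 | h0
    · simp only [burgTerm, ← h0, if_true]
      have := hp.1 j
      simp [this]
    · have hpj : 0 < p j := by
        by_contra hc
        nlinarith [h j, hw j, mul_nonneg (sub_nonneg.2 (not_lt.1 hc)) (hw j).le]
      have hr : 0 < p j / q j := div_pos hpj h0
      have h1 : -Real.log (w j) ≤ Real.log (p j / q j) := by
        rw [← Real.log_inv]
        apply Real.log_le_log (inv_pos.2 (hw j))
        rw [inv_eq_one_div, div_le_div_iff₀ (hw j) h0]
        simpa using h j
      have h2 := Real.log_le_sub_one_of_pos hr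
      have h3 : q j * (p j / q j) = p j := by field_simp
      constructor
      · nlinarith
      · rw [burgTerm, if_neg h0.ne', burgPhi, if_pos hr, ← ENNReal.ofReal_mul h0.le]
        apply ENNReal.ofReal_le_ofReal
        nlinarith
  have hsum : ∑ j, (q j * Real.log (w j) + p j - q j) = ∑ j, q j * Real.log (w j) := by
    rw [Finset.sum_sub_distrib, Finset.sum_add_distrib, hp.2, hq.2, add_sub_cancel_right]
  rw [← hsum]
  refine ⟨Finset.sum_nonneg fun j _ => (key j).1, ?_⟩
  rw [ENNReal.ofReal_sum_of_nonneg fun j _ => (key j).1]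
  exact Finset.sum_le_sum fun j _ => (key j).2

/-- Weak duality: a certificate `w = 1 + α (b - θ)` with large expected logarithm excludes that
the `α`-weighted excess of `pᵀ b` over `θ` is negative. -/
lemma sum_mul_excess_nonneg {S A : ℕ} {κ θ : ℝ} {q b p : Fin A → Fin S → ℝ} {α : Fin A → ℝ}
    (hκ : 0 < κ) (hq : ∀ a, q a ∈ stdSimplex ℝ (Fin S))
    (hw : ∀ a j, 0 < 1 + α a * (b a j - θ))
    (hg : κ < ∑ a, ∑ j, q a j * Real.log (1 + α a * (b a j - θ))) (hp : p ∈ ambiguitySet κ q) :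
    0 ≤ ∑ a, α a * ((∑ j, p a j * b a j) - θ) := by
  have h1 : ENNReal.ofReal (∑ a, ∑ j, (q a j * Real.log (1 + α a * (b a j - θ)) + p a j
      - p a j * (1 + α a * (b a j - θ)))) ≤ ENNReal.ofReal κ := by
    refine le_trans ?_ hp.2
    refine (ofReal_sum_le _ _).trans (Finset.sum_le_sum fun a _ => ?_)
    refine (ofReal_sum_le _ _).trans (Finset.sum_le_sum fun j _ => ?_)
    -- With w = 1 + α(b - θ) the terms p - p w equal -p α(b - θ), so summation produces the
    -- Lagrangian.
    exact ofReal_le_burgTerm ((hq a).1 j) ((hp.1 a).1 j) (hw a j)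
  rw [ENNReal.ofReal_le_ofReal_iff hκ.le] at h1
  have h2 : ∀ a, α a * ((∑ j, p a j * b a j) - θ) = ∑ j, (p a j * (α a * (b a j - θ))) := by
    intro a
    have := (hp.1 a).2
    calc α a * ((∑ j, p a j * b a j) - θ) = α a * ((∑ j, p a j * b a j) - (∑ j, p a j) * θ) := by
          rw [this, one_mul]
      _ = _ := by
          rw [Finset.sum_mul, ← Finset.sum_sub_distrib, Finset.mul_sum]
          exact Finset.sum_congr rfl fun j _ => by ring
  have h3 : (∑ a, ∑ j, (q a j * Real.log (1 + α a * (b a j - θ)) + p a j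
      - p a j * (1 + α a * (b a j - θ)))) =
      (∑ a, ∑ j, q a j * Real.log (1 + α a * (b a j - θ))) -
        ∑ a, α a * ((∑ j, p a j * b a j) - θ) := by
    simp_rw [h2]
    rw [← Finset.sum_sub_distrib]
    refine Finset.sum_congr rfl fun a _ => ?_
    rw [← Finset.sum_sub_distrib]
    exact Finset.sum_congr rfl fun j _ => by ring
  linarith

/-! ### The dual of the projection problem -/

noncomputable section

/-- The denominators of the tilted distribution with parameter `u`. -/
def tilt (θ bm u x : ℝ) : ℝ := (1 - u) * (θ - bm) + u * (x - bm)

/-- The negative derivative of the dual objective. -/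
def slope {ι : Type*} (s : Finset ι) (q b : ι → ℝ) (θ bm u : ℝ) : ℝ :=
  ∑ i ∈ s, q i * (θ - b i) / tilt θ bm u (b i)

/-- The dual objective. -/
def gain {ι : Type*} (s : Finset ι) (q b : ι → ℝ) (θ bm u : ℝ) : ℝ :=
  ∑ i ∈ s, q i * Real.log (tilt θ bm u (b i) / (θ - bm))

end

lemma tilt_pos {θ bm u x : ℝ} (hθ : bm < θ) (hx : bm ≤ x) (h0 : 0 ≤ u) (h1 : u < 1) :
    0 < tilt θ bm u x :=
  add_pos_of_pos_of_nonneg (mul_pos (by linarith) (by linarith)) (mul_nonneg h0 (by linarith))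

/-- The stationarity condition suggests the tilted weights q(θ - bm)/`tilt`. Their total mass is 1 +
uG with G the slope, hence at most 1, and the missing mass -uG is placed on a minimiser of b. The
mean is then exactly θ - (θ - bm)(1 - u)G, and adding mass only lowers the divergence bound, which
stays at `gain`. -/
lemma exists_primal_of_slope {S : ℕ} {q b : Fin S → ℝ} {θ bm u e : ℝ}
    (hq : q ∈ stdSimplex ℝ (Fin S)) (hb : ∀ j, bm ≤ b j) (hm : ∃ j, b j = bm) (hθ : bm < θ)
    (h0 : 0 ≤ u) (h1 : u < 1) (hG : u * slope Finset.univ q b θ bm u ≤ 0)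
    (he : -((θ - bm) * (1 - u) * slope Finset.univ q b θ bm u) ≤ e) :
    ∃ p ∈ stdSimplex ℝ (Fin S), ∑ j, p j * b j ≤ θ + e ∧
      0 ≤ gain Finset.univ q b θ bm u ∧
      burgDiv p q ≤ ENNReal.ofReal (gain Finset.univ q b θ bm u) := by
  classical
  obtain ⟨j0, hj0⟩ := hm
  set G := slope Finset.univ q b θ bm u with hGdef
  have hh : 0 < θ - bm := by linarith
  have hW : ∀ j, 0 < tilt θ bm u (b j) := fun j => tilt_pos hθ (hb j) h0 h1
  -- This rests on θ - bm = `tilt` + u(θ - b).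
  have hsum : ∑ j, q j * (θ - bm) / tilt θ bm u (b j) = 1 + u * G := by
    rw [hGdef, slope, Finset.mul_sum, ← hq.2, ← Finset.sum_add_distrib]
    refine Finset.sum_congr rfl fun j _ => ?_
    have := (hW j).ne'
    field_simp
    simp only [tilt]
    ring
  let p : Fin S → ℝ := fun j => q j * (θ - bm) / tilt θ bm u (b j) + if j = j0 then -(u * G) else 0
  have hbase : ∀ j, 0 ≤ q j * (θ - bm) / tilt θ bm u (b j) := fun j =>
    div_nonneg (mul_nonneg (hq.1 j) hh.le) (hW j).le
  have hpge : ∀ j, q j * (θ - bm) / tilt θ bm u (b j) ≤ p j := fun j => by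
    simp only [p]
    split_ifs <;> linarith
  have hp : p ∈ stdSimplex ℝ (Fin S) := by
    refine ⟨fun j => (hbase j).trans (hpge j), ?_⟩
    simp only [p]
    rw [Finset.sum_add_distrib, hsum, Finset.sum_ite_eq' Finset.univ j0]
    simp
  refine ⟨p, hp, ?_, ?_⟩
  · have : ∑ j, p j * b j - θ = -((θ - bm) * (1 - u) * G) := by
      calc ∑ j, p j * b j - θ = ∑ j, p j * b j - (∑ j, p j) * θ := by rw [hp.2, one_mul]
        _ = ∑ j, (-(θ - bm) * (q j * (θ - b j) / tilt θ bm u (b j)) +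
              (if j = j0 then -(u * G) * (b j - θ) else 0)) := by
            rw [Finset.sum_mul, ← Finset.sum_sub_distrib]
            refine Finset.sum_congr rfl fun j _ => ?_
            simp only [p]
            split_ifs <;> ring
        _ = _ := by
            rw [Finset.sum_add_distrib, Finset.sum_ite_eq' Finset.univ j0, ← Finset.mul_sum]
            rw [if_pos (Finset.mem_univ _), hj0]
            change -(θ - bm) * G + _ = _
            ring
    linarith
  · refine burgDiv_le_of_le_mul hp hq (fun j => div_pos (hW j) hh) fun j => ?_
    have := mul_le_mul_of_nonneg_right (hpge j) (div_pos (hW j) hh).le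
    have h2 : q j * (θ - bm) / tilt θ bm u (b j) * (tilt θ bm u (b j) / (θ - bm)) = q j := by
      have := (hW j).ne'
      field_simp
    linarith

/-- Accuracy of the bisection for the dual problem. -/
lemma neg_slope_le_of_bracket {ι : Type*} {s : Finset ι} {q b : ι → ℝ} {θ bm lo hi R ε : ℝ}
    (hq : ∀ i ∈ s, 0 ≤ q i) (hq1 : ∑ i ∈ s, q i = 1) (hb : ∀ i ∈ s, bm ≤ b i)
    (hbR : ∀ i ∈ s, b i ≤ bm + R) (hθ : ε / 2 ≤ θ - bm) (hθR : θ - bm ≤ R) (hε : 0 < ε)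
    (hεR : ε < R) (h0 : 0 ≤ lo) (h01 : lo ≤ hi) (h1 : hi ≤ 1 - ε / (4 * R))
    (hG : 0 < slope s q b θ bm hi ∨ hi = 1 - ε / (4 * R))
    (hw : hi - lo ≤ ε ^ 2 / (8 * R ^ 2)) :
    -((θ - bm) * (1 - lo) * slope s q b θ bm lo) ≤ ε := by
  have hR : 0 < R := hε.trans hεR
  set h := θ - bm with hh
  have hpos : 0 < h := by linarith
  -- η is the distance of the upper end of the search interval from 1, which keeps `tilt` away from
  -- 0. The width tolerance is 2η².
  set η := ε / (4 * R) with hη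
  have hη0 : 0 < η := by positivity
  have hηR : η * R = ε / 4 := by rw [hη]; field_simp
  have hη4 : η < 1 / 4 := by
    rw [hη, div_lt_div_iff₀ (by positivity) (by norm_num)]; linarith
  have htol : ε ^ 2 / (8 * R ^ 2) = 2 * η ^ 2 := by rw [hη]; field_simp; norm_num
  rw [htol] at hw
  have hlt : bm < θ := by linarith
  have hWlo : ∀ i ∈ s, 0 < tilt θ bm lo (b i) := fun i hi' =>
    tilt_pos hlt (hb i hi') h0 (by linarith)
  have hWhi : ∀ i ∈ s, 0 < tilt θ bm hi (b i) := fun i hi' =>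
    tilt_pos hlt (hb i hi') (h0.trans h01) (by linarith)
  rcases hG with hG | hG
  · have hη1 : 0 ≤ h * (1 - lo) := mul_nonneg hpos.le (by linarith)
    have key : ∀ i ∈ s, h * (1 - lo) * (q i * (θ - b i) / tilt θ bm hi (b i)
        - q i * (θ - b i) / tilt θ bm lo (b i)) ≤ q i * ε := by
      intro i hi'
      have a1 := hWlo i hi'
      have a2 := hWhi i hi'
      have e1 : h * (1 - lo) * (q i * (θ - b i) / tilt θ bm hi (b i)
        - q i * (θ - b i) / tilt θ bm lo (b i)) =
          q i * ((hi - lo) * ((h * (1 - lo) / tilt θ bm lo (b i)) *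
            ((θ - b i) ^ 2 / tilt θ bm hi (b i)))) := by
        field_simp
        simp only [tilt]
        ring
      rw [e1]
      refine mul_le_mul_of_nonneg_left ?_ (hq i hi')
      have f1 : h * (1 - lo) / tilt θ bm lo (b i) ≤ 1 := by
        rw [div_le_one a1, tilt]
        nlinarith [mul_nonneg h0 (sub_nonneg.2 (hb i hi'))]
      -- For b ≤ θ the denominator may be as small as ηh, but the numerator is at most hR. For b ≥ θ
      -- the denominator is at least h ≥ ε/2, while the numerator is only bounded by R².
      have f2 : (θ - b i) ^ 2 / tilt θ bm hi (b i) ≤ R / η := by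
        rw [div_le_div_iff₀ a2 hη0]
        have hbi := hb i hi'
        have hbRi := hbR i hi'
        rcases le_total (b i) θ with hbt | hbt
        · have g1 : η * h ≤ tilt θ bm hi (b i) := by
            rw [tilt]
            nlinarith [mul_nonneg (h0.trans h01) (sub_nonneg.2 (hb i hi')),
              mul_le_mul_of_nonneg_right h1 hpos.le]
          have g2 : (θ - b i) ^ 2 ≤ h * R := by nlinarith
          calc (θ - b i) ^ 2 * η ≤ h * R * η := by gcongr
            _ = R * (η * h) := by ring
            _ ≤ _ := by gcongr
        · have g1 : ε / 2 ≤ tilt θ bm hi (b i) := by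
            have : tilt θ bm hi (b i) = h + hi * (b i - θ) := by rw [tilt]; ring
            rw [this]
            nlinarith [mul_nonneg (h0.trans h01) (sub_nonneg.2 hbt)]
          have g2 : (θ - b i) ^ 2 ≤ R * R := by nlinarith
          calc (θ - b i) ^ 2 * η ≤ R * R * η := by gcongr
            _ = R * (η * R) := by ring
            _ ≤ _ := by
              rw [hηR]
              gcongr
              linarith
      have f3 : 0 ≤ (θ - b i) ^ 2 / tilt θ bm hi (b i) := by positivity
      have f4 : h * (1 - lo) / tilt θ bm lo (b i) * ((θ - b i) ^ 2 / tilt θ bm hi (b i)) ≤ R / η :=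
        (mul_le_of_le_one_left f3 f1).trans f2
      have f5 : (2 * η ^ 2) * (R / η) = ε / 2 := by
        field_simp; linarith
      calc _ ≤ (hi - lo) * (R / η) := mul_le_mul_of_nonneg_left f4 (by linarith)
        _ ≤ (2 * η ^ 2) * (R / η) := mul_le_mul_of_nonneg_right hw (by positivity)
        _ ≤ ε := by linarith
    have hsum := Finset.sum_le_sum key
    rw [← Finset.mul_sum, Finset.sum_sub_distrib, ← Finset.sum_mul, hq1, one_mul] at hsum
    change h * (1 - lo) * (slope s q b θ bm hi - slope s q b θ bm lo) ≤ ε at hsum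
    rw [mul_sub] at hsum
    linarith [mul_nonneg hη1 hG.le]
  -- The bracket sits at the cap: 1 - lo ≤ η + 2η² ≤ 2η makes the prefactor at most ε/2, and lo ≥
  -- 1/2 bounds the negative slope by 2.
  · have hη2 : η ^ 2 ≤ 1 / 4 * η := by rw [sq]; exact mul_le_mul_of_nonneg_right hη4.le hη0.le
    have hlo : 1 / 2 ≤ lo := by linarith
    have key : ∀ i ∈ s, -(q i * (θ - b i) / tilt θ bm lo (b i)) ≤ q i * 2 := by
      intro i hi'
      have : -(q i * (θ - b i) / tilt θ bm lo (b i)) =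
        q i * ((b i - θ) / tilt θ bm lo (b i)) := by ring
      rw [this]
      refine mul_le_mul_of_nonneg_left ?_ (hq i hi')
      rw [div_le_iff₀ (hWlo i hi'), tilt]
      have := hb i hi'
      have g1 := mul_nonneg (by linarith : 0 ≤ 1 - lo) (sub_pos.2 hlt).le
      have g2 := mul_nonneg (sub_nonneg.2 hlo) (sub_nonneg.2 this)
      linarith
    have hsum := Finset.sum_le_sum key
    rw [← Finset.sum_mul, hq1, one_mul, Finset.sum_neg_distrib] at hsum
    change -slope s q b θ bm lo ≤ 2 at hsum
    have h2 : h * (1 - lo) ≤ ε / 2 := by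
      have : 1 - lo ≤ 2 * η := by linarith
      calc h * (1 - lo) ≤ R * (2 * η) := mul_le_mul hθR this (by linarith) hR.le
        _ = ε / 2 := by linarith
    have h3 := mul_le_mul_of_nonneg_left hsum (mul_nonneg hpos.le (by linarith : 0 ≤ 1 - lo))
    linarith

/-! ### Bounds for the robust Bellman operator -/

lemma self_mem_ambiguitySet {S A : ℕ} {κ : ℝ} {q : Fin A → Fin S → ℝ}
    (hq : ∀ a, q a ∈ stdSimplex ℝ (Fin S)) : q ∈ ambiguitySet κ q := by
  refine ⟨hq, ?_⟩
  have : ∀ a, burgDiv (q a) (q a) ≤ 0 := fun a => by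
    have := (burgDiv_le_of_le_mul (w := fun _ => 1) (hq a) (hq a) (fun _ => one_pos)
      (fun j => by simp)).2
    simpa using this
  refine (Finset.sum_le_sum fun a _ => this a).trans ?_
  simp

/-! ### Policies and transition kernels as lower and upper certificates for the operator. -/

namespace Data

variable {S A : ℕ} {D : Data S A}

/-- The vectors `r_sa + disc * v`. -/
def target (D : Data S A) (s : Fin S) (a : Fin A) (j : Fin S) : ℝ := D.r s a j + D.disc * D.v j

lemma Admissible.r_le (hD : D.Admissible) (s : Fin S) (a : Fin A) (j : Fin S) :
    D.r s a j ≤ (1 - D.disc) * D.Rbar := by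
  have h1 : 0 < 1 - D.disc := by linarith [hD.disc_lt_one]
  rw [Rbar, mul_inv_cancel_left₀ h1.ne']
  exact le_ciSup (f := fun i : Fin S × Fin A × Fin S => D.r i.1 i.2.1 i.2.2)
    (Set.finite_range _).bddAbove (s, a, j)

lemma Admissible.target_nonneg (hD : D.Admissible) (s : Fin S) (a : Fin A) (j : Fin S) :
    0 ≤ D.target s a j := hD.b_nonneg s a j

lemma Admissible.target_le (hD : D.Admissible) (s : Fin S) (a : Fin A) (j : Fin S) :
    D.target s a j ≤ D.Rbar := by
  have h1 := hD.r_le s a j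
  have h2 := mul_le_mul_of_nonneg_left (hD.v_le j) hD.disc_pos.le
  unfold target
  linarith

lemma sum_mul_le_of_mem_stdSimplex {n : ℕ} {p f : Fin n → ℝ} {c : ℝ}
    (hp : p ∈ stdSimplex ℝ (Fin n)) (hf : ∀ j, f j ≤ c) : ∑ j, p j * f j ≤ c := by
  calc ∑ j, p j * f j ≤ ∑ j, p j * c :=
        Finset.sum_le_sum fun j _ => mul_le_mul_of_nonneg_left (hf j) (hp.1 j)
    _ = c := by rw [← Finset.sum_mul, hp.2, one_mul]

lemma le_sum_mul_of_mem_stdSimplex {n : ℕ} {p f : Fin n → ℝ} {c : ℝ}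
    (hp : p ∈ stdSimplex ℝ (Fin n)) (hf : ∀ j, c ≤ f j) : c ≤ ∑ j, p j * f j := by
  calc c = ∑ j, p j * c := by rw [← Finset.sum_mul, hp.2, one_mul]
    _ ≤ ∑ j, p j * f j :=
        Finset.sum_le_sum fun j _ => mul_le_mul_of_nonneg_left (hf j) (hp.1 j)

lemma Admissible.bddBelow_range (hD : D.Admissible) (s : Fin S) (π : stdSimplex ℝ (Fin A)) :
    BddBelow (Set.range fun p : ambiguitySet D.κ (D.pbar s) =>
      ∑ a, π.1 a * ∑ s', p.1 a s' * (D.r s a s' + D.disc * D.v s')) := by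
  refine ⟨0, ?_⟩
  rintro _ ⟨p, rfl⟩
  exact le_sum_mul_of_mem_stdSimplex π.2 fun a =>
    le_sum_mul_of_mem_stdSimplex (p.2.1 a) fun j => hD.b_nonneg s a j

lemma Admissible.iInf_le (hD : D.Admissible) {s : Fin S} {p : Fin A → Fin S → ℝ} {c : ℝ}
    (hp : p ∈ ambiguitySet D.κ (D.pbar s)) (hc : ∀ a, ∑ j, p a j * D.target s a j ≤ c)
    (π : stdSimplex ℝ (Fin A)) :
    ⨅ p : ambiguitySet D.κ (D.pbar s),
      ∑ a, π.1 a * ∑ s', p.1 a s' * (D.r s a s' + D.disc * D.v s') ≤ c :=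
  (ciInf_le (hD.bddBelow_range s π) ⟨p, hp⟩).trans (sum_mul_le_of_mem_stdSimplex π.2 hc)

/-- A single p that is good for all actions is good against every policy. Only the easy direction of
the minimax inequality is involved. -/
lemma Admissible.bellman_le (hD : D.Admissible) (hA : 0 < A) {s : Fin S}
    {p : Fin A → Fin S → ℝ} {c : ℝ}
    (hp : p ∈ ambiguitySet D.κ (D.pbar s)) (hc : ∀ a, ∑ j, p a j * D.target s a j ≤ c) :
    D.bellman s ≤ c := by
  have : NeZero A := ⟨hA.ne'⟩
  have : Nonempty (stdSimplex ℝ (Fin A)) := ⟨⟨_, single_mem_stdSimplex ℝ (0 : Fin A)⟩⟩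
  exact ciSup_le fun π => hD.iInf_le hp hc π

lemma Admissible.le_bellman (hD : D.Admissible) {s : Fin S} {c : ℝ} {π : Fin A → ℝ}
    (hπ : π ∈ stdSimplex ℝ (Fin A))
    (hc : ∀ p ∈ ambiguitySet D.κ (D.pbar s), c ≤ ∑ a, π a * ∑ j, p a j * D.target s a j) :
    c ≤ D.bellman s := by
  have hself : D.pbar s ∈ ambiguitySet D.κ (D.pbar s) := self_mem_ambiguitySet (hD.pbar_mem s)
  have : Nonempty (ambiguitySet D.κ (D.pbar s)) := ⟨⟨_, hself⟩⟩
  refine le_ciSup_of_le ⟨D.Rbar, ?_⟩ ⟨π, hπ⟩ (le_ciInf fun p => hc p.1 p.2)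
  rintro _ ⟨π', rfl⟩
  exact hD.iInf_le hself
    (fun a => sum_mul_le_of_mem_stdSimplex (hD.pbar_mem s a) fun j => hD.target_le s a j) π'

lemma Admissible.bellman_le_Rbar (hD : D.Admissible) (hA : 0 < A) (s : Fin S) :
    D.bellman s ≤ D.Rbar :=
  hD.bellman_le hA (self_mem_ambiguitySet (hD.pbar_mem s))
    fun a => sum_mul_le_of_mem_stdSimplex (hD.pbar_mem s a) fun j => hD.target_le s a j

lemma Admissible.le_bellman_of_le_target (hD : D.Admissible) {s : Fin S} {c : ℝ} {a : Fin A}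
    (hc : ∀ j, c ≤ D.target s a j) : c ≤ D.bellman s := by
  classical
  refine hD.le_bellman (single_mem_stdSimplex ℝ a) fun p hp => ?_
  rw [Finset.sum_eq_single a (fun a' _ h => by simp [h]) (by simp)]
  rw [Pi.single_eq_same, one_mul]
  exact le_sum_mul_of_mem_stdSimplex (hp.1 a) hc

/-- A dual certificate bounds the robust Bellman operator from below. -/
lemma Admissible.le_bellman_of_lt_gain (hD : D.Admissible) {s : Fin S} {θ : ℝ} {bm u : Fin A → ℝ}
    (hb : ∀ a j, bm a ≤ D.target s a j) (hθ : ∀ a, bm a < θ) (h0 : ∀ a, 0 ≤ u a)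
    (h1 : ∀ a, u a < 1)
    (hg : D.κ < ∑ a, gain Finset.univ (D.pbar s a) (D.target s a) θ (bm a) (u a)) :
    θ ≤ D.bellman s := by
  set α : Fin A → ℝ := fun a => u a / (θ - bm a) with hα
  have hpos : ∀ a, 0 < θ - bm a := fun a => by linarith [hθ a]
  have hα0 : ∀ a, 0 ≤ α a := fun a => div_nonneg (h0 a) (hpos a).le
  have hw : ∀ a j, tilt θ (bm a) (u a) (D.target s a j) / (θ - bm a) =
      1 + α a * (D.target s a j - θ) := fun a j => by
    have := (hpos a).ne'
    simp only [hα, tilt]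
    field_simp
    ring
  have hwpos : ∀ a j, 0 < 1 + α a * (D.target s a j - θ) := fun a j => by
    rw [← hw]
    exact div_pos (tilt_pos (hθ a) (hb a j) (h0 a) (h1 a)) (hpos a)
  have hg' : D.κ < ∑ a, ∑ j, D.pbar s a j * Real.log (1 + α a * (D.target s a j - θ)) := by
    simpa only [gain, hw] using hg
  -- If all multipliers vanished the total gain would be 0, contrary to κ > 0.
  have hsum : 0 < ∑ a, α a := by
    refine (Finset.sum_nonneg fun a _ => hα0 a).lt_of_ne' fun h => ?_
    rw [Finset.sum_eq_zero_iff_of_nonneg fun a _ => hα0 a] at h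
    have : ∑ a, ∑ j, D.pbar s a j * Real.log (1 + α a * (D.target s a j - θ)) = 0 :=
      Finset.sum_eq_zero fun a ha => Finset.sum_eq_zero fun j _ => by simp [h a ha]
    linarith [hD.κ_pos]
  -- The policy is the normalised vector of dual multipliers.
  refine hD.le_bellman (π := fun a => α a / ∑ a, α a)
    ⟨fun a => div_nonneg (hα0 a) hsum.le, by rw [← Finset.sum_div, div_self hsum.ne']⟩
    fun p hp => ?_
  have key := sum_mul_excess_nonneg hD.κ_pos (hD.pbar_mem s) hwpos hg' hp
  simp_rw [mul_sub] at key
  rw [Finset.sum_sub_distrib, ← Finset.sum_mul] at key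
  have : ∑ a, α a / (∑ a, α a) * ∑ j, p a j * D.target s a j =
      (∑ a, α a * ∑ j, p a j * D.target s a j) / ∑ a, α a := by
    rw [Finset.sum_div]
    exact Finset.sum_congr rfl fun a _ => by ring
  rw [this, le_div_iff₀ hsum]
  linarith

/-- Nearly stationary dual points of small total objective bound the robust Bellman operator from
above. -/
lemma Admissible.bellman_le_of_gain_le (hD : D.Admissible) (hA : 0 < A) {s : Fin S} {θ e : ℝ}
    {bm u : Fin A → ℝ} (hb : ∀ a j, bm a ≤ D.target s a j) (hm : ∀ a, ∃ j, D.target s a j = bm a)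
    (hθ : ∀ a, bm a < θ) (h0 : ∀ a, 0 ≤ u a) (h1 : ∀ a, u a < 1)
    (hG : ∀ a, u a * slope Finset.univ (D.pbar s a) (D.target s a) θ (bm a) (u a) ≤ 0)
    (he : ∀ a, -((θ - bm a) * (1 - u a) *
      slope Finset.univ (D.pbar s a) (D.target s a) θ (bm a) (u a)) ≤ e)
    (hg : ∑ a, gain Finset.univ (D.pbar s a) (D.target s a) θ (bm a) (u a) ≤ D.κ) :
    D.bellman s ≤ θ + e := by
  choose p hp hpb hg0 hpd using fun a => exists_primal_of_slope (hD.pbar_mem s a) (hb a) (hm a)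
    (hθ a) (h0 a) (h1 a) (hG a) (he a)
  refine hD.bellman_le hA (p := p) ⟨hp, ?_⟩ hpb
  refine (Finset.sum_le_sum fun a _ => hpd a).trans ?_
  rw [← ENNReal.ofReal_sum_of_nonneg]
  · exact ENNReal.ofReal_le_ofReal hg
  · exact fun a _ => hg0 a

/-- For a large budget the worst case nearly attains the smallest targets. -/
lemma Admissible.bellman_le_of_large_budget (hD : D.Admissible) (hA : 0 < A) {s : Fin S}
    {m ε : ℝ} (hε : 0 < ε) (hm : ∀ a, ∃ j, D.target s a j ≤ m) (hm0 : 0 ≤ m)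
    (hκ : A * D.Rbar ≤ D.κ * ε) : D.bellman s ≤ m + ε := by
  classical
  rcases le_or_gt D.Rbar ε with hR | hR
  · linarith [hD.bellman_le_Rbar hA s]
  have hR0 : 0 < D.Rbar := hε.trans hR
  choose j0 hj0 using hm
  -- Retaining a fraction z of the nominal mass and moving the rest to a small target costs at most
  -- log(1/z) ≤ R/ε per action and raises the mean above m by at most zR = ε.
  set z := ε / D.Rbar with hz
  have hz0 : 0 < z := by positivity
  have hz1 : z < 1 := by rw [hz, div_lt_one hR0]; exact hR
  let p : Fin A → Fin S → ℝ := fun a j =>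
    z * D.pbar s a j + (1 - z) * (Pi.single (j0 a) 1 : Fin S → ℝ) j
  have hp : ∀ a, p a ∈ stdSimplex ℝ (Fin S) := fun a =>
    convex_stdSimplex ℝ (Fin S) (hD.pbar_mem s a) (single_mem_stdSimplex ℝ (j0 a)) hz0.le
      (by linarith) (by ring)
  refine hD.bellman_le hA (p := p) ⟨hp, ?_⟩ fun a => ?_
  · have h1 : ∀ a, burgDiv (p a) (D.pbar s a) ≤ ENNReal.ofReal (D.Rbar / ε) := fun a => by
      refine (burgDiv_le_of_le_mul (w := fun _ => z⁻¹) (hp a) (hD.pbar_mem s a)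
        (fun _ => inv_pos.2 hz0) fun j => ?_).2.trans (ENNReal.ofReal_le_ofReal ?_)
      · rw [← div_eq_mul_inv, le_div_iff₀ hz0]
        have : 0 ≤ (1 - z) * (Pi.single (j0 a) 1 : Fin S → ℝ) j :=
          mul_nonneg (by linarith) ((single_mem_stdSimplex ℝ (j0 a)).1 j)
        simp only [p]
        linarith
      · rw [← Finset.sum_mul, (hD.pbar_mem s a).2, one_mul, hz, inv_div]
        exact (Real.log_le_sub_one_of_pos (by positivity)).trans (by linarith)
    refine (Finset.sum_le_sum fun a _ => h1 a).trans ?_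
    rw [← ENNReal.ofReal_sum_of_nonneg fun _ _ => by positivity]
    apply ENNReal.ofReal_le_ofReal
    rw [Finset.sum_const, Finset.card_univ, Fintype.card_fin, nsmul_eq_mul, ← mul_div_assoc,
      div_le_iff₀ hε]
    exact hκ
  · have h1 : ∑ j, p a j * D.target s a j =
        z * ∑ j, D.pbar s a j * D.target s a j + (1 - z) * D.target s a (j0 a) := by
      have : D.target s a (j0 a) =
          ∑ j, (Pi.single (j0 a) 1 : Fin S → ℝ) j * D.target s a j := by
        rw [Finset.sum_eq_single (j0 a) (fun j _ h => by simp [h]) (by simp)]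
        simp
      rw [this, Finset.mul_sum, Finset.mul_sum, ← Finset.sum_add_distrib]
      exact Finset.sum_congr rfl fun j _ => by simp only [p]; ring
    have h2 : ∑ j, D.pbar s a j * D.target s a j ≤ D.Rbar :=
      sum_mul_le_of_mem_stdSimplex (hD.pbar_mem s a) fun j => hD.target_le s a j
    have h3 : z * D.Rbar = ε := by rw [hz]; field_simp
    rw [h1]
    nlinarith [mul_le_mul_of_nonneg_left h2 hz0.le,
      mul_le_mul_of_nonneg_left (hj0 a) (by linarith : 0 ≤ 1 - z), mul_nonneg hz0.le hm0]

end Data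

/-! ### Reasoning about programs -/

/-- Started in `σ`, the command `c` halts within `K` units of time in a memory with property `Q`. -/
def Runs (c : Cmd) (σ : State) (K : ℕ) (Q : State → Prop) : Prop :=
  ∃ τ t, Exec c σ τ t ∧ t ≤ K ∧ Q τ

namespace Runs

variable {c d : Cmd} {b : BExp} {σ : State} {K K₁ K₂ : ℕ} {Q R : State → Prop}

lemma mono (h : Runs c σ K₁ Q) (hK : K₁ ≤ K) : Runs c σ K Q := by
  obtain ⟨τ, t, h1, h2, h3⟩ := h
  exact ⟨τ, t, h1, h2.trans hK, h3⟩

lemma imp (h : Runs c σ K Q) (hQ : ∀ τ, Q τ → R τ) : Runs c σ K R := by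
  obtain ⟨τ, t, h1, h2, h3⟩ := h
  exact ⟨τ, t, h1, h2, hQ τ h3⟩

lemma skip (h : Q σ) : Runs .skip σ 1 Q := ⟨_, _, .skip σ, le_rfl, h⟩

lemma iset {x : ℕ} {e : IExp} (h : Q (σ.setIdx x (e.eval σ))) :
    Runs (.iset x e) σ (e.cost + 1) Q := ⟨_, _, .iset x e σ, le_rfl, h⟩

lemma rset {x : ℕ} {e : RExp} (h : Q (σ.setReg x (e.eval σ))) :
    Runs (.rset x e) σ (e.cost + 1) Q := ⟨_, _, .rset x e σ, le_rfl, h⟩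

lemma aset {n : ℕ} {i j k : IExp} {e : RExp}
    (h : Q (σ.setArr n (i.eval σ) (j.eval σ) (k.eval σ) (e.eval σ))) :
    Runs (.aset n i j k e) σ (i.cost + j.cost + k.cost + e.cost + 1) Q :=
  ⟨_, _, .aset n i j k e σ, le_rfl, h⟩

lemma seq (h : Runs c σ K₁ R) (h' : ∀ τ, R τ → Runs d τ K₂ Q) :
    Runs (.seq c d) σ (K₁ + K₂) Q := by
  obtain ⟨τ, t, h1, h2, h3⟩ := h
  obtain ⟨ρ, u, k1, k2, k3⟩ := h' τ h3
  exact ⟨ρ, t + u, .seq h1 k1, add_le_add h2 k2, k3⟩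

lemma rset_seq {x : ℕ} {e : RExp} (h : Runs d (σ.setReg x (e.eval σ)) K Q) :
    Runs (.seq (.rset x e) d) σ (e.cost + 1 + K) Q :=
  seq (R := fun τ => τ = σ.setReg x (e.eval σ)) (rset rfl) fun _ hτ => hτ ▸ h

lemma iset_seq {x : ℕ} {e : IExp} (h : Runs d (σ.setIdx x (e.eval σ)) K Q) :
    Runs (.seq (.iset x e) d) σ (e.cost + 1 + K) Q :=
  seq (R := fun τ => τ = σ.setIdx x (e.eval σ)) (iset rfl) fun _ hτ => hτ ▸ h

lemma ite (h : b.holds σ → Runs c σ K₁ Q) (h' : ¬ b.holds σ → Runs d σ K₂ Q) :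
    Runs (.ite b c d) σ (b.cost + 1 + max K₁ K₂) Q := by
  by_cases hb : b.holds σ
  · obtain ⟨τ, t, h1, h2, h3⟩ := h hb
    exact ⟨τ, _, .iteTrue hb h1, by omega, h3⟩
  · obtain ⟨τ, t, h1, h2, h3⟩ := h' hb
    exact ⟨τ, _, .iteFalse hb h1, by omega, h3⟩

/-- The index of I bounds the number of iterations still to come. The loop may stop before the index
reaches 0, hence the existential in the conclusion. -/
lemma whileLoop {I : ℕ → State → Prop} (h0 : ∀ τ, I 0 τ → ¬ b.holds τ)
    (hs : ∀ n τ, I (n + 1) τ → b.holds τ → Runs c τ K (I n)) {n : ℕ} (hσ : I n σ) :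
    Runs (.while b c) σ (n * (b.cost + 1 + K) + (b.cost + 1))
      fun τ => (∃ m, I m τ) ∧ ¬ b.holds τ := by
  induction n generalizing σ with
  | zero => exact ⟨σ, _, .whileFalse (h0 σ hσ), by omega, ⟨0, hσ⟩, h0 σ hσ⟩
  | succ n ih =>
    by_cases hb : b.holds σ
    · obtain ⟨τ, t, h1, h2, h3⟩ := hs n σ hσ hb
      obtain ⟨ρ, u, k1, k2, k3⟩ := ih h3
      refine ⟨ρ, _, .whileTrue hb h1 k1, ?_, k3⟩
      rw [Nat.succ_mul]
      omega
    · exact ⟨σ, _, .whileFalse hb, by omega, ⟨_, hσ⟩, hb⟩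

end Runs

/-- `for x = 0, …, y - 1 do c`, where `x` and `y` are index registers. -/
def forLoop (x y : ℕ) (c : Cmd) : Cmd :=
  .seq (.iset x (.const 0))
    (.while (.ilt (.var x) (.var y)) (.seq c (.iset x (.add (.var x) (.const 1)))))

/-- P is required after the counter is incremented, since it may depend on the counter. The 8 units
per round pay for test, branching and increment; the 6 units pay for initialisation and the last
test. -/
lemma Runs.for {x y N K : ℕ} {c : Cmd} {σ : State} (P : ℕ → State → Prop) (hxy : y ≠ x)
    (hN : σ.idx y = N) (h0 : P 0 (σ.setIdx x 0))
    (hs : ∀ i < N, ∀ τ, τ.idx x = i → τ.idx y = N → P i τ → Runs c τ K fun τ' =>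
      τ'.idx x = i ∧ τ'.idx y = N ∧ P (i + 1) (τ'.setIdx x (i + 1))) :
    Runs (forLoop x y c) σ (N * (K + 8) + 6) (P N) := by
  have hw := Runs.whileLoop (b := .ilt (.var x) (.var y))
    (c := .seq c (.iset x (.add (.var x) (.const 1)))) (K := K + 4) (n := N)
    (σ := σ.setIdx x 0)
    (I := fun n τ => n ≤ N ∧ τ.idx x = N - n ∧ τ.idx y = N ∧ P (N - n) τ) ?_ ?_ ?_
  · refine (Runs.iset_seq (hw.imp ?_)).mono ?_
    · rintro τ ⟨⟨m, hm, h1, h2, h3⟩, h4⟩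
      simp only [BExp.holds, IExp.eval, h1, h2] at h4
      have : N - m = N := by omega
      rwa [this] at h3
    · simp only [BExp.cost, IExp.cost]
      ring_nf
      omega
  · rintro τ ⟨-, h1, h2, -⟩
    simp [BExp.holds, IExp.eval, h1, h2]
  · rintro n τ ⟨hn, h1, h2, h3⟩ -
    refine Runs.seq (K₂ := 4) (hs (N - (n + 1)) (by omega) τ h1 h2 h3) ?_
    rintro τ' ⟨k1, k2, k3⟩
    refine Runs.iset ?_
    have e : N - (n + 1) + 1 = N - n := by omega
    simp only [IExp.eval, k1, e] at k3 ⊢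
    refine ⟨by omega, by simp [State.setIdx], by simp [State.setIdx, hxy, k2], k3⟩
  · refine ⟨le_rfl, by simp [State.setIdx], by simp [State.setIdx, hxy, hN], ?_⟩
    simpa using h0

/-- `τ` agrees with `σ` in the arrays, the index registers below `k` and the real registers below
`l`. -/
structure Frame (k l : ℕ) (σ τ : State) : Prop where
  idx : ∀ x < k, τ.idx x = σ.idx x
  reg : ∀ x < l, τ.reg x = σ.reg x
  arr : τ.arr = σ.arr

namespace Frame

variable {k l k' l' : ℕ} {σ τ ρ : State}

lemma refl : Frame k l σ σ := ⟨fun _ _ => rfl, fun _ _ => rfl, rfl⟩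

lemma trans (h : Frame k l σ τ) (h' : Frame k' l' τ ρ) (hk : k ≤ k' := by omega)
    (hl : l ≤ l' := by omega) : Frame k l σ ρ :=
  ⟨fun x hx => (h'.idx x (by omega)).trans (h.idx x hx),
    fun x hx => (h'.reg x (by omega)).trans (h.reg x hx), h'.arr.trans h.arr⟩

lemma mono (h : Frame k' l' σ τ) (hk : k ≤ k' := by omega) (hl : l ≤ l' := by omega) :
    Frame k l σ τ := refl.trans h

lemma setIdx (h : Frame k l σ τ) {x n : ℕ} (hx : k ≤ x := by omega) :
    Frame k l σ (τ.setIdx x n) :=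
  ⟨fun y hy => by simp only [State.setIdx]; rw [if_neg (by omega), h.idx y hy], h.reg, h.arr⟩

lemma setReg (h : Frame k l σ τ) {x : ℕ} {t : ℝ} (hx : l ≤ x := by omega) :
    Frame k l σ (τ.setReg x t) :=
  ⟨h.idx, fun y hy => by simp only [State.setReg]; rw [if_neg (by omega), h.reg y hy], h.arr⟩

end Frame

/-- Suited to nested loops: the body leaves the counter, all lower index registers and real
registers below `l` untouched, so the frame itself is part of the invariant. -/
lemma Runs.for_frame {x y l N K : ℕ} {c : Cmd} {σ : State} (hy : y < x) (hN : σ.idx y = N)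
    (P : ℕ → State → Prop) (hP : ∀ i n τ, P i τ → P i (τ.setIdx x n)) (h0 : P 0 σ)
    (hs : ∀ i < N, ∀ τ, τ.idx x = i → Frame x l σ τ → P i τ →
      Runs c τ K fun τ' => Frame (x + 1) l τ τ' ∧ P (i + 1) τ') :
    Runs (forLoop x y c) σ (N * (K + 8) + 6) fun τ => Frame x l σ τ ∧ P N τ := by
  refine Runs.for (fun i τ => Frame x l σ τ ∧ P i τ) hy.ne hN ⟨Frame.refl.setIdx, hP _ _ _ h0⟩ ?_
  rintro i hi τ h1 - ⟨h3, h4⟩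
  refine (hs i hi τ h1 h3 h4).imp ?_
  rintro τ' ⟨h5, h6⟩
  have h7 : Frame x l σ τ' := h3.trans h5
  exact ⟨(h5.idx x (by omega)).trans h1, (h7.idx y hy).trans hN, h7.setIdx, hP _ _ _ h6⟩

/-! ### The program -/

noncomputable section

/-- The nominal distribution for the state in index register `2`. -/
def State.nominal (σ : State) (a j : ℕ) : ℝ := σ.arr 0 (σ.idx 2) a j

/-- The target vector for the state in index register `2`. -/
def State.target (σ : State) (a j : ℕ) : ℝ :=
  σ.arr 1 (σ.idx 2) a j + σ.reg 0 * σ.arr 2 j 0 0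

end

lemma Frame.nominal_eq {k l : ℕ} {σ τ : State} (h : Frame k l σ τ) (hk : 2 < k := by omega) :
    τ.nominal = σ.nominal := by
  funext a j
  simp only [State.nominal, h.arr, h.idx 2 hk]

lemma Frame.target_eq {k l : ℕ} {σ τ : State} (h : Frame k l σ τ) (hk : 2 < k := by omega)
    (hl : 0 < l := by omega) : τ.target = σ.target := by
  funext a j
  simp only [State.target, h.arr, h.idx 2 hk, h.reg 0 hl]

namespace Program

/-- Memory layout. Index registers 2, 3, 4 run over s, a, s'. Real registers: 0 to 2 hold λ, κ, ε; 3
holds R; 4 and 5 the bracket for the value; 6 is θ; 7 accumulates the gains; 8 is bm; 9 and 10 are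
the bracket for u with midpoint in 11; 12 is the summation register. Inner routines write only to
higher numbers, so `Frame` describes what they preserve. -/
def nominalExp : RExp := .arr 0 (.var 2) (.var 3) (.var 4)

def targetExp : RExp :=
  .add (.arr 1 (.var 2) (.var 3) (.var 4)) (.mul (.var 0) (.arr 2 (.var 4) (.const 0) (.const 0)))

lemma eval_targetExp (σ : State) : targetExp.eval σ = σ.target (σ.idx 3) (σ.idx 4) := rfl

lemma eval_nominalExp (σ : State) : nominalExp.eval σ = σ.nominal (σ.idx 3) (σ.idx 4) := rfl

/-- Real register `12` receives the sum of the values of `e` over index register `4`. -/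
def sumLoop (e : RExp) : Cmd :=
  .seq (.rset 12 (.ofIdx (.const 0))) (forLoop 4 0 (.rset 12 (.add (.var 12) e)))

/-- The summand may read anything outside the summation register and the loop counter; its value
then depends on the counter alone. -/
lemma runs_sumLoop {e : RExp} {σ : State} {f : ℕ → ℝ} {S : ℕ} (hS : σ.idx 0 = S)
    (he : ∀ τ, Frame 4 12 σ τ → e.eval τ = f (τ.idx 4)) :
    Runs (sumLoop e) σ (S * (e.cost + 11) + 9) fun τ =>
      Frame 4 12 σ τ ∧ τ.reg 12 = ∑ j ∈ Finset.range S, f j := by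
  refine Runs.mono (Runs.rset_seq (Runs.imp (Runs.for_frame (x := 4) (y := 0) (l := 12)
    (K := e.cost + 3) (by norm_num) (by exact hS)
    (fun i τ => τ.reg 12 = ∑ j ∈ Finset.range i, f j) (fun _ _ _ h => h) ?_ ?_) ?_)) ?_
  · simp [State.setReg, RExp.eval, IExp.eval]
  · intro i hi τ h1 h2 h3
    refine Runs.mono (Runs.rset ⟨Frame.refl.setReg, ?_⟩) ?_
    · simp only [State.setReg, if_true, RExp.eval]
      rw [h3, Finset.sum_range_succ, he τ (Frame.trans (Frame.refl.setReg) h2), h1]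
    · simp only [RExp.cost]
      omega
  · exact fun τ h => ⟨Frame.trans (Frame.refl.setReg) h.1, h.2⟩
  · simp only [RExp.cost, IExp.cost]
    ring_nf
    omega

/-- Real register `8` receives the smallest target for the action in index register `3`. -/
def minTarget : Cmd :=
  .seq (.iset 4 (.const 0)) (.seq (.rset 8 targetExp)
    (forLoop 4 0 (.ite (.rlt targetExp (.var 8)) (.rset 8 targetExp) .skip)))

/-- `bm` is the minimum of `b 0, …, b (S - 1)`. -/
structure IsMin (S : ℕ) (b : ℕ → ℝ) (bm : ℝ) : Prop where
  le : ∀ j < S, bm ≤ b j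
  exists_eq : ∃ j < S, b j = bm

lemma runs_minTarget {σ : State} {S : ℕ} (hS : σ.idx 0 = S) (hpos : 0 < S) :
    Runs minTarget σ (60 * S) fun τ =>
      Frame 4 8 σ τ ∧ IsMin S (σ.target (σ.idx 3)) (τ.reg 8) := by
  refine Runs.mono (Runs.iset_seq (Runs.rset_seq (Runs.imp (Runs.for_frame (x := 4) (y := 0) (l := 8)
    (K := 26) (by norm_num) (N := S) ?_
    (fun i τ => (∀ j < i, τ.reg 8 ≤ σ.target (σ.idx 3) j) ∧
      ∃ j < S, σ.target (σ.idx 3) j = τ.reg 8) (fun _ _ _ h => h) ?_ ?_) ?_))) ?_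
  · simpa [State.setReg, State.setIdx] using hS
  · exact ⟨by simp, 0, hpos, rfl⟩
  · rintro i hi τ h1 h2 ⟨h3, h4⟩
    have h2' : Frame 4 8 σ τ := Frame.trans (Frame.setReg (Frame.refl.setIdx)) h2
    have hev : targetExp.eval τ = σ.target (σ.idx 3) i := by
      rw [eval_targetExp, h2'.target_eq, h2'.idx 3 (by omega), h1]
    refine Runs.mono (Runs.ite (fun hb => Runs.rset ⟨Frame.refl.setReg, ?_⟩)
      (fun hb => Runs.skip ⟨Frame.refl, ?_⟩)) ?_
    · simp only [BExp.holds, hev, RExp.eval] at hb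
      simp only [State.setReg, if_true, hev]
      refine ⟨fun j hj => ?_, i, hi, rfl⟩
      rcases Nat.lt_succ_iff_lt_or_eq.1 hj with hj | rfl
      · exact hb.le.trans (h3 j hj)
      · exact le_rfl
    · simp only [BExp.holds, hev, RExp.eval, not_lt] at hb
      refine ⟨fun j hj => ?_, h4⟩
      rcases Nat.lt_succ_iff_lt_or_eq.1 hj with hj | rfl
      · exact h3 j hj
      · exact hb
    · simp [BExp.cost, RExp.cost, IExp.cost, targetExp]
  · rintro τ ⟨h1, h2, h3⟩
    exact ⟨Frame.trans (Frame.setReg (Frame.refl.setIdx)) h1, h2, h3⟩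
  · simp only [RExp.cost, IExp.cost, targetExp]
    omega

/-! ### Inner bisection: the dual of the projection problem for one action. -/

/-- The denominator `tilt`, with parameter in real register `x`. -/
def tiltExp (x : ℕ) : RExp :=
  .add (.mul (.sub (.ofIdx (.const 1)) (.var x)) (.sub (.var 6) (.var 8)))
    (.mul (.var x) (.sub targetExp (.var 8)))

def slopeExp : RExp := .div (.mul nominalExp (.sub (.var 6) targetExp)) (tiltExp 11)

def gainExp : RExp := .mul nominalExp (.log (.div (tiltExp 9) (.sub (.var 6) (.var 8))))

lemma eval_tiltExp (x : ℕ) (σ : State) : (tiltExp x).eval σ =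
    tilt (σ.reg 6) (σ.reg 8) (σ.reg x) (σ.target (σ.idx 3) (σ.idx 4)) := by
  simp only [tiltExp, RExp.eval, eval_targetExp, IExp.eval, Nat.cast_one, tilt]

def half (x y : ℕ) : RExp := .div (.add (.var x) (.var y)) (.ofIdx (.const 2))

/-- One step of the bisection for the dual problem. -/
def dualStep : Cmd :=
  .seq (.rset 11 (half 9 10)) (.seq (sumLoop slopeExp)
    (.ite (.rlt (.ofIdx (.const 0)) (.var 12)) (.rset 10 (.var 11)) (.rset 9 (.var 11))))

/-- Bisection for the dual problem, with result in real register `9`. -/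
def dualSearch : Cmd :=
  .seq (.rset 9 (.ofIdx (.const 0)))
    (.seq (.rset 10 (.sub (.ofIdx (.const 1))
      (.div (.var 2) (.mul (.ofIdx (.const 4)) (.var 3)))))
    (.while (.rlt (.div (.mul (.var 2) (.var 2)) (.mul (.ofIdx (.const 8)) (.mul (.var 3) (.var 3))))
      (.sub (.var 10) (.var 9))) dualStep))

/-- The bracket `[u, u']` in the bisection for the dual problem. -/
structure Bracket (S : ℕ) (q b : ℕ → ℝ) (θ bm ε R u u' : ℝ) : Prop where
  nonneg : 0 ≤ u
  le : u ≤ u'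
  le_top : u' ≤ 1 - ε / (4 * R)
  slope_left : u * slope (Finset.range S) q b θ bm u ≤ 0
  slope_right : 0 < slope (Finset.range S) q b θ bm u' ∨ u' = 1 - ε / (4 * R)

/-- Both slope conditions of `Bracket` hold trivially at the initial ends: the factor u vanishes at
0, and the cap is allowed as an alternative on the right. Each midpoint satisfies one of them
according to the sign of its slope, without appeal to monotonicity. -/
lemma runs_dualStep {σ : State} {S : ℕ} (hS : σ.idx 0 = S) (hpos : 0 < S)
    (hbr : Bracket S (σ.nominal (σ.idx 3)) (σ.target (σ.idx 3)) (σ.reg 6) (σ.reg 8) (σ.reg 2)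
      (σ.reg 3) (σ.reg 9) (σ.reg 10)) :
    Runs dualStep σ (100 * S) fun τ => Frame 4 9 σ τ ∧
      Bracket S (σ.nominal (σ.idx 3)) (σ.target (σ.idx 3)) (σ.reg 6) (σ.reg 8) (σ.reg 2)
        (σ.reg 3) (τ.reg 9) (τ.reg 10) ∧
      τ.reg 10 - τ.reg 9 = (σ.reg 10 - σ.reg 9) / 2 := by
  set mid := (σ.reg 9 + σ.reg 10) / 2 with hmid
  have hev : (half 9 10).eval σ = mid := by simp [half, RExp.eval, IExp.eval, hmid]
  have hl := hbr.le
  have h0 := hbr.nonneg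
  have ht := hbr.le_top
  have hS' : (σ.setReg 11 mid).idx 0 = S := hS
  have hloop : Runs (sumLoop slopeExp) (σ.setReg 11 ((half 9 10).eval σ))
      (S * (slopeExp.cost + 11) + 9) fun τ => Frame 4 12 (σ.setReg 11 mid) τ ∧ τ.reg 12 =
        slope (Finset.range S) (σ.nominal (σ.idx 3)) (σ.target (σ.idx 3)) (σ.reg 6) (σ.reg 8)
          mid := by
    rw [hev]
    refine runs_sumLoop hS' fun τ h => ?_
    have h' : Frame 4 9 σ τ := Frame.trans (Frame.refl.setReg) h
    have h11 : τ.reg 11 = mid := by rw [h.reg 11 (by omega)]; rfl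
    simp only [slopeExp, RExp.eval, eval_targetExp, eval_nominalExp, eval_tiltExp,
      h'.target_eq, h'.nominal_eq, h'.idx 3 (by omega), h'.reg 6 (by omega), h'.reg 8 (by omega),
      h11]
  refine Runs.mono (Runs.rset_seq (Runs.seq hloop ?_)) (K₁ := (half 9 10).cost + 1 +
    (S * (slopeExp.cost + 11) + 9 + 7)) ?_
  · rintro τ ⟨h, hsum⟩
    have h' : Frame 4 9 σ τ := Frame.trans (Frame.refl.setReg) h
    have h11 : τ.reg 11 = mid := by rw [h.reg 11 (by omega)]; rfl
    have h9 : τ.reg 9 = σ.reg 9 := h.reg 9 (by omega)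
    have h10 : τ.reg 10 = σ.reg 10 := h.reg 10 (by omega)
    refine Runs.ite (fun hb => Runs.rset ⟨h'.setReg, ?_⟩) (fun hb => Runs.rset ⟨h'.setReg, ?_⟩)
    · simp only [BExp.holds, RExp.eval, IExp.eval, Nat.cast_zero, hsum] at hb
      simp only [State.setReg, RExp.eval, h11, h9, if_true, if_neg (by norm_num : ¬ (9 : ℕ) = 10)]
      exact ⟨⟨h0, by linarith, by linarith, hbr.slope_left, Or.inl hb⟩, by rw [hmid]; ring⟩
    · simp only [BExp.holds, RExp.eval, IExp.eval, Nat.cast_zero, hsum, not_lt] at hb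
      simp only [State.setReg, RExp.eval, h11, h10, if_true, if_neg (by norm_num : ¬ (10 : ℕ) = 9)]
      exact ⟨⟨by linarith, by linarith, ht, mul_nonpos_of_nonneg_of_nonpos (by linarith) hb,
        hbr.slope_right⟩, by rw [hmid]; ring⟩
  · simp only [RExp.cost, IExp.cost, half, slopeExp, tiltExp, targetExp, nominalExp]
    omega

/-- The initial width is at most 1, so N halvings reach the tolerance. -/
lemma runs_dualSearch {σ : State} {S N : ℕ} (hS : σ.idx 0 = S) (hpos : 0 < S)
    (hε : 0 < σ.reg 2) (hR : σ.reg 2 < σ.reg 3)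
    (hN : 1 ≤ σ.reg 2 ^ 2 / (8 * σ.reg 3 ^ 2) * 2 ^ N) :
    Runs dualSearch σ ((N + 1) * (160 * S)) fun τ => Frame 4 9 σ τ ∧ ∃ u',
      Bracket S (σ.nominal (σ.idx 3)) (σ.target (σ.idx 3)) (σ.reg 6) (σ.reg 8) (σ.reg 2)
        (σ.reg 3) (τ.reg 9) u' ∧ u' - τ.reg 9 ≤ σ.reg 2 ^ 2 / (8 * σ.reg 3 ^ 2) := by
  have hR0 : 0 < σ.reg 3 := hε.trans hR
  have hη : σ.reg 2 / (4 * σ.reg 3) ≤ 1 := by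
    rw [div_le_one (by positivity)]; linarith
  have hη0 : 0 < σ.reg 2 / (4 * σ.reg 3) := by positivity
  set tol := σ.reg 2 ^ 2 / (8 * σ.reg 3 ^ 2) with htol
  refine Runs.mono (Runs.rset_seq (Runs.rset_seq (Runs.imp (Runs.whileLoop (n := N) (K := 100 * S)
    (I := fun n τ => Frame 4 9 σ τ ∧ Bracket S (σ.nominal (σ.idx 3)) (σ.target (σ.idx 3))
      (σ.reg 6) (σ.reg 8) (σ.reg 2) (σ.reg 3) (τ.reg 9) (τ.reg 10) ∧
      τ.reg 10 - τ.reg 9 ≤ tol * 2 ^ n) ?_ ?_ ?_) ?_))) ?_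
  · rintro τ ⟨h1, h2, h3⟩
    simp only [BExp.holds, RExp.eval, IExp.eval, h1.reg 2 (by omega), h1.reg 3 (by omega), not_lt]
    simpa [htol, sq] using h3
  · rintro n τ ⟨h1, h2, h3⟩ -
    refine (runs_dualStep (σ := τ) ((h1.idx 0 (by omega)).trans hS) hpos ?_).imp ?_
    · simpa only [h1.target_eq, h1.nominal_eq, h1.idx 3 (by omega), h1.reg 6 (by omega),
        h1.reg 8 (by omega), h1.reg 2 (by omega), h1.reg 3 (by omega)] using h2
    · rintro τ' ⟨k1, k2, k3⟩
      refine ⟨h1.trans k1, ?_, ?_⟩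
      · simpa only [h1.target_eq, h1.nominal_eq, h1.idx 3 (by omega), h1.reg 6 (by omega),
          h1.reg 8 (by omega), h1.reg 2 (by omega), h1.reg 3 (by omega)] using k2
      · rw [k3]
        rw [pow_succ] at h3
        linarith
  · refine ⟨Frame.setReg (Frame.refl.setReg), ?_, ?_⟩
    · simp only [State.setReg, RExp.eval, IExp.eval, if_true, if_neg (by norm_num : ¬ (9 : ℕ) = 10),
        if_neg (by norm_num : ¬ (2 : ℕ) = 9), if_neg (by norm_num : ¬ (3 : ℕ) = 9)]
      push_cast
      exact ⟨le_rfl, by linarith, le_rfl, by simp, Or.inr rfl⟩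
    · simp only [State.setReg, RExp.eval, IExp.eval, if_true, if_neg (by norm_num : ¬ (9 : ℕ) = 10),
        if_neg (by norm_num : ¬ (2 : ℕ) = 9), if_neg (by norm_num : ¬ (3 : ℕ) = 9)]
      push_cast
      linarith
  · rintro τ ⟨⟨m, h1, h2, -⟩, h3⟩
    refine ⟨h1, _, h2, ?_⟩
    simp only [BExp.holds, RExp.eval, IExp.eval, h1.reg 2 (by omega), h1.reg 3 (by omega),
      not_lt] at h3
    simpa [htol, sq] using h3
  · simp [RExp.cost, IExp.cost, BExp.cost]
    nlinarith

/-- A minimum `bm` of the targets and an approximate solution `u` of the dual problem. -/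
structure DualPoint (S : ℕ) (q b : ℕ → ℝ) (θ ε R bm u : ℝ) : Prop where
  isMin : IsMin S b bm
  exists_bracket : ∃ u', Bracket S q b θ bm ε R u u' ∧ u' - u ≤ ε ^ 2 / (8 * R ^ 2)

/-- Adds the dual objective for the action in index register `3` to real register `7`. -/
def actionStep : Cmd :=
  .seq minTarget (.seq dualSearch (.seq (sumLoop gainExp) (.rset 7 (.add (.var 7) (.var 12)))))

/-- The pair bm, u is existential because its registers are overwritten for the next action; only
the accumulated gain survives in memory. -/
lemma runs_actionStep {σ : State} {S N : ℕ} (hS : σ.idx 0 = S) (hpos : 0 < S)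
    (hε : 0 < σ.reg 2) (hR : σ.reg 2 < σ.reg 3)
    (hN : 1 ≤ σ.reg 2 ^ 2 / (8 * σ.reg 3 ^ 2) * 2 ^ N) :
    Runs actionStep σ ((N + 1) * (300 * S)) fun τ => Frame 4 7 σ τ ∧ ∃ bm u,
      DualPoint S (σ.nominal (σ.idx 3)) (σ.target (σ.idx 3)) (σ.reg 6) (σ.reg 2) (σ.reg 3) bm u ∧
      τ.reg 7 = σ.reg 7 + gain (Finset.range S) (σ.nominal (σ.idx 3)) (σ.target (σ.idx 3))
        (σ.reg 6) bm u := by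
  refine Runs.mono (Runs.seq (runs_minTarget hS hpos) (K₂ := (N + 1) * (160 * S) +
    (S * (gainExp.cost + 11) + 9 + 4)) ?_) ?_
  · rintro τ ⟨h1, hmin⟩
    have r2 := h1.reg 2 (by omega)
    have r3 := h1.reg 3 (by omega)
    have r6 := h1.reg 6 (by omega)
    have r7 := h1.reg 7 (by omega)
    have i3 := h1.idx 3 (by omega)
    refine Runs.seq (runs_dualSearch (N := N) ((h1.idx 0 (by omega)).trans hS) hpos
      (by rwa [r2]) (by rwa [r2, r3]) (by rwa [r2, r3])) ?_
    rintro ρ ⟨h2, u', hbr, hu⟩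
    have h12 : Frame 4 8 σ ρ := h1.trans h2
    refine Runs.seq (runs_sumLoop (f := fun j => σ.nominal (σ.idx 3) j *
      Real.log (tilt (σ.reg 6) (τ.reg 8) (ρ.reg 9) (σ.target (σ.idx 3) j) / (σ.reg 6 - τ.reg 8)))
      ((h12.idx 0 (by omega)).trans hS) ?_) ?_
    · intro ν h3
      have h123 : Frame 4 8 σ ν := h12.trans h3
      simp only [gainExp, RExp.eval, eval_nominalExp, eval_tiltExp,
        h123.target_eq, h123.nominal_eq, h123.idx 3 (by omega), h123.reg 6 (by omega),
        h3.reg 8 (by omega), h2.reg 8 (by omega), h3.reg 9 (by omega)]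
    · rintro ν ⟨h3, hsum⟩
      have h123 : Frame 4 8 σ ν := h12.trans h3
      refine Runs.rset ⟨h123.mono.setReg, τ.reg 8, ρ.reg 9, ⟨hmin, u', ?_⟩, ?_⟩
      · rw [h1.nominal_eq, h1.target_eq, i3, r6, r2, r3] at hbr
        rw [r2, r3] at hu
        exact ⟨hbr, hu⟩
      · simp only [State.setReg, if_true, RExp.eval, hsum, h123.reg 7 (by omega)]
        rfl
  · simp only [RExp.cost, IExp.cost, gainExp, tiltExp, targetExp, nominalExp]
    nlinarith

/-! ### Outer bisection: the value at one state. -/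

/-- One step of the bisection for the value. -/
def valueStep : Cmd :=
  .seq (.rset 6 (half 4 5)) (.seq (.rset 7 (.ofIdx (.const 0))) (.seq (forLoop 3 1 actionStep)
    (.ite (.rlt (.var 1) (.var 7)) (.rset 4 (.var 6)) (.rset 5 (.var 6)))))

lemma runs_valueStep {σ : State} {S A N : ℕ} (hS : σ.idx 0 = S) (hA : σ.idx 1 = A) (hpos : 0 < S)
    (hApos : 0 < A) (hε : 0 < σ.reg 2) (hR : σ.reg 2 < σ.reg 3)
    (hN : 1 ≤ σ.reg 2 ^ 2 / (8 * σ.reg 3 ^ 2) * 2 ^ N) :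
    Runs valueStep σ ((N + 1) * (340 * (S * A))) fun τ => Frame 3 4 σ τ ∧ ∃ bm u : ℕ → ℝ,
      (∀ a < A, DualPoint S (σ.nominal a) (σ.target a) ((σ.reg 4 + σ.reg 5) / 2) (σ.reg 2)
        (σ.reg 3) (bm a) (u a)) ∧
      ((σ.reg 1 < ∑ a ∈ Finset.range A, gain (Finset.range S) (σ.nominal a) (σ.target a)
          ((σ.reg 4 + σ.reg 5) / 2) (bm a) (u a) ∧ τ.reg 4 = (σ.reg 4 + σ.reg 5) / 2 ∧
          τ.reg 5 = σ.reg 5) ∨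
        (∑ a ∈ Finset.range A, gain (Finset.range S) (σ.nominal a) (σ.target a)
          ((σ.reg 4 + σ.reg 5) / 2) (bm a) (u a) ≤ σ.reg 1 ∧ τ.reg 4 = σ.reg 4 ∧
          τ.reg 5 = (σ.reg 4 + σ.reg 5) / 2)) := by
  classical
  set θ := (σ.reg 4 + σ.reg 5) / 2 with hθ
  have hev : (half 4 5).eval σ = θ := by simp [half, RExp.eval, IExp.eval, hθ]
  set σ' := (σ.setReg 6 ((half 4 5).eval σ)).setReg 7
    ((RExp.ofIdx (.const 0)).eval (σ.setReg 6 ((half 4 5).eval σ))) with hσ'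
  have h0 : Frame 4 6 σ σ' := (Frame.refl.setReg).setReg
  have h06 : σ'.reg 6 = θ := by simp [hσ', State.setReg, hev]
  have hloop : Runs (forLoop 3 1 actionStep) σ' (A * ((N + 1) * (300 * S) + 8) + 6) fun τ =>
      Frame 3 7 σ' τ ∧ ∃ bm u : ℕ → ℝ,
        (∀ a < A, DualPoint S (σ.nominal a) (σ.target a) θ (σ.reg 2) (σ.reg 3) (bm a) (u a)) ∧
        τ.reg 7 = ∑ a ∈ Finset.range A, gain (Finset.range S) (σ.nominal a) (σ.target a) θ
          (bm a) (u a) := by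
    refine Runs.for_frame (by norm_num) ((h0.idx 1 (by omega)).trans hA) (fun i τ =>
      ∃ bm u : ℕ → ℝ,
        (∀ a < i, DualPoint S (σ.nominal a) (σ.target a) θ (σ.reg 2) (σ.reg 3) (bm a) (u a)) ∧
        τ.reg 7 = ∑ a ∈ Finset.range i, gain (Finset.range S) (σ.nominal a) (σ.target a) θ
          (bm a) (u a)) (fun _ _ _ h => h) ⟨0, 0, by simp, by
            simp [hσ', State.setReg, RExp.eval, IExp.eval]⟩ ?_
    rintro i hi τ hτ h1 ⟨bm, u, hd, hsum⟩
    have h01 : Frame 3 6 σ τ := Frame.trans h0.mono h1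
    have r2 := h01.reg 2 (by omega)
    have r3 := h01.reg 3 (by omega)
    have r6 : τ.reg 6 = θ := (h1.reg 6 (by omega)).trans h06
    refine (runs_actionStep ((h01.idx 0 (by omega)).trans hS) hpos (by rwa [r2]) (by rwa [r2, r3])
      (by rwa [r2, r3])).imp ?_
    rintro ρ ⟨h2, bmi, ui, hdi, hsumi⟩
    rw [h01.nominal_eq, h01.target_eq, hτ, r6, r2, r3] at hdi
    rw [h01.nominal_eq, h01.target_eq, hτ, r6, hsum] at hsumi
    -- The dual points of earlier actions are kept as ghost data, extended at the current action.
    refine ⟨h2, Function.update bm i bmi, Function.update u i ui, fun a ha => ?_, ?_⟩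
    · rcases Nat.lt_succ_iff_lt_or_eq.1 ha with ha | rfl
      · simpa [ha.ne] using hd a ha
      · simpa using hdi
    · rw [hsumi, Finset.sum_range_succ, Function.update_self, Function.update_self]
      congr 1
      refine Finset.sum_congr rfl fun a ha => ?_
      have := (Finset.mem_range.1 ha).ne
      simp [this]
  refine Runs.mono (Runs.rset_seq (Runs.rset_seq (Runs.seq hloop (K₂ := 6) ?_))) ?_
  · rintro τ ⟨h1, bm, u, hd, hsum⟩
    have h01 : Frame 3 6 σ τ := Frame.trans h0.mono h1
    have r6 : τ.reg 6 = θ := (h1.reg 6 (by omega)).trans h06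
    refine Runs.ite (fun hb => Runs.rset ⟨h01.mono.setReg, bm, u, hd, Or.inl ?_⟩)
      (fun hb => Runs.rset ⟨h01.mono.setReg, bm, u, hd, Or.inr ?_⟩)
    · simp only [BExp.holds, RExp.eval, hsum, h01.reg 1 (by omega)] at hb
      exact ⟨hb, by simpa [State.setReg, RExp.eval] using r6,
        by simpa [State.setReg] using h01.reg 5 (by omega)⟩
    · simp only [BExp.holds, RExp.eval, hsum, h01.reg 1 (by omega), not_lt] at hb
      exact ⟨hb, by simpa [State.setReg] using h01.reg 4 (by omega),
        by simpa [State.setReg, RExp.eval] using r6⟩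
  · simp only [RExp.cost, IExp.cost, half]
    have : 0 < S * A := Nat.mul_pos hpos hApos
    have : A ≤ S * A := Nat.le_mul_of_pos_left A hpos
    nlinarith

/-- Bisection for the value between the real registers `4` and `5`, with result in `5`. -/
def valueSearch : Cmd := .while (.rlt (.var 2) (.sub (.var 5) (.var 4))) valueStep

/-- The invariant keeps the lower end below J exactly and lets J exceed the upper end by at most ε.
The error of the test therefore does not accumulate, and a final width of at most ε gives accuracy
ε. The condition on N is needed only if the body can run: for R = 0 the tolerance would be a
division by zero. -/
lemma runs_valueSearch {σ : State} {S A M N : ℕ} {J : ℝ} (hS : σ.idx 0 = S) (hA : σ.idx 1 = A)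
    (hpos : 0 < S) (hApos : 0 < A) (hε : 0 < σ.reg 2) (h4 : 0 ≤ σ.reg 4) (h5 : σ.reg 5 ≤ σ.reg 3)
    (hM : σ.reg 5 - σ.reg 4 ≤ σ.reg 2 * 2 ^ M)
    (hN : 0 < M → 1 ≤ σ.reg 2 ^ 2 / (8 * σ.reg 3 ^ 2) * 2 ^ N)
    (hJ4 : σ.reg 4 ≤ J) (hJ5 : J ≤ σ.reg 5 + σ.reg 2)
    (htest : ∀ θ, σ.reg 4 + σ.reg 2 / 2 ≤ θ → θ ≤ σ.reg 3 → σ.reg 2 < σ.reg 3 →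
      ∀ bm u : ℕ → ℝ,
      (∀ a < A, DualPoint S (σ.nominal a) (σ.target a) θ (σ.reg 2) (σ.reg 3) (bm a) (u a)) →
      (σ.reg 1 < ∑ a ∈ Finset.range A, gain (Finset.range S) (σ.nominal a) (σ.target a) θ
        (bm a) (u a) → θ ≤ J) ∧
      (∑ a ∈ Finset.range A, gain (Finset.range S) (σ.nominal a) (σ.target a) θ
        (bm a) (u a) ≤ σ.reg 1 → J ≤ θ + σ.reg 2)) :
    Runs valueSearch σ ((M * (N + 1) + 1) * (350 * (S * A))) fun τ =>
      Frame 3 4 σ τ ∧ |τ.reg 5 - J| ≤ σ.reg 2 := by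
  refine Runs.mono (Runs.imp (Runs.whileLoop (n := M) (K := (N + 1) * (340 * (S * A)))
    (I := fun n τ => n ≤ M ∧ Frame 3 4 σ τ ∧ σ.reg 4 ≤ τ.reg 4 ∧ τ.reg 5 ≤ σ.reg 3 ∧
      τ.reg 4 ≤ J ∧ J ≤ τ.reg 5 + σ.reg 2 ∧ τ.reg 5 - τ.reg 4 ≤ σ.reg 2 * 2 ^ n) ?_ ?_ ?_) ?_) ?_
  · rintro τ ⟨-, h, -, -, -, -, h1⟩
    simpa [BExp.holds, RExp.eval, h.reg 2 (by omega)] using h1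
  · rintro n τ ⟨hn, h, k4, k5, kJ4, kJ5, hw⟩ hb
    have r2 := h.reg 2 (by omega)
    have r3 := h.reg 3 (by omega)
    simp only [BExp.holds, RExp.eval, r2] at hb
    have hεR : σ.reg 2 < σ.reg 3 := by linarith
    refine (runs_valueStep (N := N) ((h.idx 0 (by omega)).trans hS) ((h.idx 1 (by omega)).trans hA)
      hpos hApos (by rwa [r2]) (by rwa [r2, r3]) (by rw [r2, r3]; exact hN (by omega))).imp ?_
    rintro τ' ⟨h', bm, u, hd, hcase⟩
    rw [h.nominal_eq, h.target_eq, r2, r3] at hd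
    rw [h.nominal_eq, h.target_eq, h.reg 1 (by omega)] at hcase
    -- Inside the loop the width exceeds ε, so the midpoint lies at least ε/2 above the initial
    -- lower end.
    obtain ⟨t1, t2⟩ := htest _ (by linarith) (by linarith) hεR bm u hd
    have hhalf : (τ.reg 5 - τ.reg 4) / 2 ≤ σ.reg 2 * 2 ^ n := by
      rw [pow_succ] at hw
      linarith
    rcases hcase with ⟨hg, e4, e5⟩ | ⟨hg, e4, e5⟩
    · have := t1 hg
      exact ⟨by omega, h.trans h', by linarith, by linarith, by linarith, by linarith,
        by linarith⟩
    · have := t2 hg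
      exact ⟨by omega, h.trans h', by linarith, by linarith, by linarith, by linarith,
        by linarith⟩
  · exact ⟨le_rfl, Frame.refl, le_rfl, h5, hJ4, hJ5, hM⟩
  · rintro τ ⟨⟨m, -, h, -, -, k1, k2, -⟩, hb⟩
    simp only [BExp.holds, RExp.eval, h.reg 2 (by omega), not_lt] at hb
    exact ⟨h, abs_le.2 ⟨by linarith, by linarith⟩⟩
  · simp only [BExp.cost, RExp.cost]
    have : 0 < S * A := Nat.mul_pos hpos hApos
    have h2 : M ≤ M * (N + 1) := Nat.le_mul_of_pos_right M (by omega)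
    have h3 : M * (N + 1) ≤ M * (N + 1) * (S * A) := Nat.le_mul_of_pos_right _ this
    nlinarith

/-- Real register `4` receives the largest of `0` and the smallest targets of all actions. -/
def maxMinTarget : Cmd :=
  .seq (.rset 4 (.ofIdx (.const 0))) (forLoop 3 1 (.seq minTarget
    (.ite (.rlt (.var 4) (.var 8)) (.rset 4 (.var 8)) .skip)))

/-- The result is a lower bound for J, attained by a pure action, and it dominates the smallest
target of every action, so every tested θ exceeds all bm by at least ε/2. Starting from 0 is
harmless because targets are nonnegative. -/
lemma runs_maxMinTarget {σ : State} {S A : ℕ} (hS : σ.idx 0 = S) (hA : σ.idx 1 = A)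
    (hpos : 0 < S) (hApos : 0 < A) :
    Runs maxMinTarget σ (90 * (S * A)) fun τ => Frame 3 4 σ τ ∧ 0 ≤ τ.reg 4 ∧
      (∀ a < A, ∃ j < S, σ.target a j ≤ τ.reg 4) ∧
      (τ.reg 4 = 0 ∨ ∃ a < A, ∀ j < S, τ.reg 4 ≤ σ.target a j) := by
  refine Runs.mono (Runs.rset_seq (Runs.imp (Runs.for_frame (x := 3) (y := 1) (l := 4) (N := A)
    (K := 60 * S + 6) (by norm_num) (by exact hA) (fun i τ => 0 ≤ τ.reg 4 ∧
      (∀ a < i, ∃ j < S, σ.target a j ≤ τ.reg 4) ∧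
      (τ.reg 4 = 0 ∨ ∃ a < A, ∀ j < S, τ.reg 4 ≤ σ.target a j)) (fun _ _ _ h => h) ?_ ?_) ?_)) ?_
  · simp [State.setReg, RExp.eval, IExp.eval]
  · rintro i hi τ hτ h ⟨h1, h2, h3⟩
    have h' : Frame 3 4 σ τ := Frame.trans (Frame.refl.setReg) h
    refine Runs.seq (runs_minTarget ((h'.idx 0 (by omega)).trans hS) hpos) ?_
    rintro ρ ⟨k, hmin⟩
    rw [h'.target_eq, hτ] at hmin
    obtain ⟨j0, hj0, hj0'⟩ := hmin.exists_eq
    have r4 := k.reg 4 (by omega)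
    refine Runs.mono (K₁ := 6) (Runs.ite (K₁ := 2) (fun hb => Runs.rset ⟨k.mono.setReg, ?_⟩)
      (fun hb => Runs.skip ⟨k.mono, ?_⟩)) le_rfl
    swap
    · simp only [BExp.holds, RExp.eval, r4] at hb
      simp only [State.setReg, RExp.eval, if_true]
      refine ⟨h1.trans hb.le, fun a ha => ?_, Or.inr ⟨i, hi, hmin.le⟩⟩
      rcases Nat.lt_succ_iff_lt_or_eq.1 ha with ha | rfl
      · obtain ⟨j, hj, hj'⟩ := h2 a ha
        exact ⟨j, hj, hj'.trans hb.le⟩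
      · exact ⟨j0, hj0, hj0'.le⟩
    · simp only [BExp.holds, RExp.eval, r4, not_lt] at hb
      rw [r4]
      refine ⟨h1, fun a ha => ?_, h3⟩
      rcases Nat.lt_succ_iff_lt_or_eq.1 ha with ha | rfl
      · exact h2 a ha
      · exact ⟨j0, hj0, hj0'.le.trans hb⟩
  · exact fun τ h => ⟨Frame.trans (Frame.refl.setReg) h.1, h.2⟩
  · simp only [RExp.cost, IExp.cost]
    have : A ≤ S * A := Nat.le_mul_of_pos_left A hpos
    nlinarith

/-- Real register `5` receives the value for the state in index register `2`. -/
def stateValue : Cmd :=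
  .seq maxMinTarget (.seq
    (.ite (.rlt (.mul (.var 1) (.var 2)) (.mul (.ofIdx (.var 1)) (.var 3)))
      (.rset 5 (.var 3)) (.rset 5 (.var 4))) valueSearch)

/-! ### The scale R and the loop over states. -/

/-- Real register `3` receives the largest reward. -/
def maxReward : Cmd :=
  .seq (.rset 3 (.ofIdx (.const 0))) (forLoop 2 0 (forLoop 3 1 (forLoop 4 0
    (.ite (.rlt (.var 3) (.arr 1 (.var 2) (.var 3) (.var 4)))
      (.rset 3 (.arr 1 (.var 2) (.var 3) (.var 4))) .skip))))

lemma runs_maxReward {σ : State} {S A : ℕ} {B : ℝ} (hS : σ.idx 0 = S) (hA : σ.idx 1 = A)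
    (hpos : 0 < S) (hApos : 0 < A) (hB0 : 0 ≤ B)
    (hB : ∀ s < S, ∀ a < A, ∀ j < S, σ.arr 1 s a j ≤ B) :
    Runs maxReward σ (60 * (S * (S * A))) fun τ => Frame 2 3 σ τ ∧ τ.reg 3 ≤ B ∧
      ∀ s < S, ∀ a < A, ∀ j < S, σ.arr 1 s a j ≤ τ.reg 3 := by
  have hbody : ∀ s < S, ∀ a < A, ∀ ρ : State, ρ.idx 0 = S → ρ.idx 1 = A → ρ.idx 2 = s →
      ρ.idx 3 = a → ρ.arr = σ.arr → ρ.reg 3 ≤ B →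
      Runs (forLoop 4 0 (.ite (.rlt (.var 3) (.arr 1 (.var 2) (.var 3) (.var 4)))
        (.rset 3 (.arr 1 (.var 2) (.var 3) (.var 4))) .skip)) ρ (S * 20 + 6) fun τ =>
        Frame 4 3 ρ τ ∧ τ.reg 3 ≤ B ∧ ρ.reg 3 ≤ τ.reg 3 ∧ ∀ j < S, σ.arr 1 s a j ≤ τ.reg 3 := by
    intro s hs a ha ρ r0 r1 r2 r3 rarr rB
    refine Runs.mono (Runs.for_frame (K := 12) (l := 3) (by norm_num) r0 (fun i τ =>
      τ.reg 3 ≤ B ∧ ρ.reg 3 ≤ τ.reg 3 ∧ ∀ j < i, σ.arr 1 s a j ≤ τ.reg 3) (fun _ _ _ h => h)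
      ⟨rB, le_rfl, by simp⟩ ?_) le_rfl
    rintro i hi τ hτ h ⟨h1, h2, h3⟩
    have hev : (RExp.arr 1 (.var 2) (.var 3) (.var 4)).eval τ = σ.arr 1 s a i := by
      simp only [RExp.eval, IExp.eval, h.arr, rarr, h.idx 2 (by omega), h.idx 3 (by omega), hτ,
        r2, r3]
    refine Runs.mono (K₁ := 12) (Runs.ite (K₁ := 5) (fun hb => Runs.rset ⟨Frame.refl.setReg, ?_⟩)
      (fun hb => Runs.skip ⟨Frame.refl, ?_⟩)) le_rfl
    swap
    · rw [BExp.holds, hev] at hb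
      simp only [RExp.eval] at hb
      simp only [State.setReg, if_true, hev]
      refine ⟨hB s hs a ha i hi, h2.trans hb.le, fun j hj => ?_⟩
      rcases Nat.lt_succ_iff_lt_or_eq.1 hj with hj | rfl
      · exact (h3 j hj).trans hb.le
      · exact le_rfl
    · rw [BExp.holds, hev] at hb
      simp only [RExp.eval, not_lt] at hb
      refine ⟨h1, h2, fun j hj => ?_⟩
      rcases Nat.lt_succ_iff_lt_or_eq.1 hj with hj | rfl
      · exact h3 j hj
      · exact hb
  have hmid : ∀ s < S, ∀ ρ : State, ρ.idx 0 = S → ρ.idx 1 = A → ρ.idx 2 = s →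
      ρ.arr = σ.arr → ρ.reg 3 ≤ B →
      Runs (forLoop 3 1 (forLoop 4 0 (.ite (.rlt (.var 3) (.arr 1 (.var 2) (.var 3) (.var 4)))
        (.rset 3 (.arr 1 (.var 2) (.var 3) (.var 4))) .skip))) ρ (A * (S * 20 + 6 + 8) + 6)
        fun τ => Frame 3 3 ρ τ ∧ τ.reg 3 ≤ B ∧ ρ.reg 3 ≤ τ.reg 3 ∧
          ∀ a < A, ∀ j < S, σ.arr 1 s a j ≤ τ.reg 3 := by
    intro s hs ρ r0 r1 r2 rarr rB
    refine Runs.for_frame (l := 3) (by norm_num) r1 (fun i τ =>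
      τ.reg 3 ≤ B ∧ ρ.reg 3 ≤ τ.reg 3 ∧ ∀ a < i, ∀ j < S, σ.arr 1 s a j ≤ τ.reg 3)
      (fun _ _ _ h => h) ⟨rB, le_rfl, by simp⟩ ?_
    rintro i hi τ hτ h ⟨h1, h2, h3⟩
    refine (hbody s hs i hi τ ((h.idx 0 (by omega)).trans r0) ((h.idx 1 (by omega)).trans r1)
      ((h.idx 2 (by omega)).trans r2) hτ (h.arr.trans rarr) h1).imp ?_
    rintro τ' ⟨k, k1, k2, k3⟩
    refine ⟨k, k1, h2.trans k2, fun a ha => ?_⟩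
    rcases Nat.lt_succ_iff_lt_or_eq.1 ha with ha | rfl
    · exact fun j hj => (h3 a ha j hj).trans k2
    · exact k3
  refine Runs.mono (Runs.rset_seq (Runs.imp (Runs.for_frame (x := 2) (y := 0) (l := 3) (N := S)
    (K := A * (S * 20 + 6 + 8) + 6) (by norm_num) (by exact hS) (fun i τ =>
      τ.reg 3 ≤ B ∧ ∀ s < i, ∀ a < A, ∀ j < S, σ.arr 1 s a j ≤ τ.reg 3)
      (fun _ _ _ h => h) ?_ ?_) ?_)) ?_
  · simpa [State.setReg, RExp.eval, IExp.eval] using hB0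
  · rintro i hi τ hτ h ⟨h1, h2⟩
    have h' : Frame 2 3 σ τ := Frame.trans (Frame.refl.setReg) h
    refine (hmid i hi τ ((h'.idx 0 (by omega)).trans hS) ((h'.idx 1 (by omega)).trans hA) hτ
      h'.arr h1).imp ?_
    rintro τ' ⟨k, k1, k2, k3⟩
    refine ⟨k, k1, fun s hs => ?_⟩
    rcases Nat.lt_succ_iff_lt_or_eq.1 hs with hs | rfl
    · exact fun a ha j hj => (h2 s hs a ha j hj).trans k2
    · exact k3
  · exact fun τ h => ⟨Frame.trans (Frame.refl.setReg) h.1, h.2⟩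
  · simp only [RExp.cost, IExp.cost]
    have h1 : A ≤ S * A := Nat.le_mul_of_pos_left A hpos
    have h2 : S * A ≤ S * (S * A) := Nat.le_mul_of_pos_left _ hpos
    have h3 : S ≤ S * A := Nat.le_mul_of_pos_right S hApos
    nlinarith

/-- The robust Bellman update. -/
def bellmanUpdate : Cmd :=
  .seq maxReward (.seq (.rset 3 (.div (.var 3) (.sub (.ofIdx (.const 1)) (.var 0))))
    (forLoop 2 0 (.seq stateValue (.aset 3 (.var 2) (.const 0) (.const 0) (.var 5)))))

end Program

/-! ### Correctness of the program -/

lemma slope_range {S : ℕ} {q b : ℕ → ℝ} {q' b' : Fin S → ℝ} (hq : ∀ j : Fin S, q j = q' j)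
    (hb : ∀ j : Fin S, b j = b' j) (θ bm u : ℝ) :
    slope (Finset.range S) q b θ bm u = slope Finset.univ q' b' θ bm u := by
  simp only [slope, Finset.sum_range, hq, hb]

lemma gain_range {S : ℕ} {q b : ℕ → ℝ} {q' b' : Fin S → ℝ} (hq : ∀ j : Fin S, q j = q' j)
    (hb : ∀ j : Fin S, b j = b' j) (θ bm u : ℝ) :
    gain (Finset.range S) q b θ bm u = gain Finset.univ q' b' θ bm u := by
  simp only [gain, Finset.sum_range, hq, hb]

namespace Program

variable {S A : ℕ} {D : Data S A}

/-- Correctness of the test in the bisection for the value. -/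
lemma bellman_of_dualPoint (hD : D.Admissible) (hA : 0 < A) {s : Fin S} {q b : ℕ → ℕ → ℝ}
    (hq : ∀ (a : Fin A) (j : Fin S), q a j = D.pbar s a j)
    (hb : ∀ (a : Fin A) (j : Fin S), b a j = D.target s a j) {ε m θ : ℝ} (hε : 0 < ε)
    (hm : ∀ a < A, ∃ j < S, b a j ≤ m) (hmθ : m + ε / 2 ≤ θ) (hθ : θ ≤ D.Rbar)
    (hεR : ε < D.Rbar) {bm u : ℕ → ℝ}
    (hd : ∀ a < A, DualPoint S (q a) (b a) θ ε D.Rbar (bm a) (u a)) :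
    (D.κ < ∑ a ∈ Finset.range A, gain (Finset.range S) (q a) (b a) θ (bm a) (u a) →
      θ ≤ D.bellman s) ∧
    (∑ a ∈ Finset.range A, gain (Finset.range S) (q a) (b a) θ (bm a) (u a) ≤ D.κ →
      D.bellman s ≤ θ + ε) := by
  have hR : 0 < D.Rbar := hε.trans hεR
  have hbm : ∀ (a : Fin A) (j : Fin S), bm a ≤ D.target s a j := fun a j =>
    hb a j ▸ (hd a a.2).isMin.le j j.2
  have hex : ∀ a : Fin A, ∃ j, D.target s a j = bm a := fun a => by
    obtain ⟨j, hj, hj'⟩ := (hd a a.2).isMin.exists_eq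
    exact ⟨⟨j, hj⟩, by rw [← hj', ← hb a ⟨j, hj⟩]⟩
  have hbm0 : ∀ a : Fin A, 0 ≤ bm a := fun a => by
    obtain ⟨j, hj⟩ := hex a
    exact hj ▸ hD.target_nonneg s a j
  have hθbm : ∀ a : Fin A, ε / 2 ≤ θ - bm a := fun a => by
    obtain ⟨j, hj, hj'⟩ := hm a a.2
    linarith [(hd a a.2).isMin.le j hj]
  have hlt : ∀ a : Fin A, bm a < θ := fun a => by linarith [hθbm a]
  have hη : 0 < ε / (4 * D.Rbar) := by positivity
  have hu0 : ∀ a : Fin A, 0 ≤ u a := fun a => by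
    obtain ⟨u', h, -⟩ := (hd a a.2).exists_bracket
    exact h.nonneg
  have hu1 : ∀ a : Fin A, u a < 1 := fun a => by
    obtain ⟨u', h, -⟩ := (hd a a.2).exists_bracket
    linarith [h.le, h.le_top]
  have hsum : ∑ a ∈ Finset.range A, gain (Finset.range S) (q a) (b a) θ (bm a) (u a) =
      ∑ a : Fin A, gain Finset.univ (D.pbar s a) (D.target s a) θ (bm a) (u a) := by
    rw [Finset.sum_range]
    exact Finset.sum_congr rfl fun a _ => gain_range (hq a) (hb a) _ _ _
  rw [hsum]
  refine ⟨fun hg => hD.le_bellman_of_lt_gain hbm hlt hu0 hu1 hg,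
    fun hg => hD.bellman_le_of_gain_le hA hbm hex hlt hu0 hu1 (fun a => ?_) (fun a => ?_) hg⟩
  · obtain ⟨u', h, -⟩ := (hd a a.2).exists_bracket
    rw [← slope_range (hq a) (hb a)]
    exact h.slope_left
  · obtain ⟨u', h, hw⟩ := (hd a a.2).exists_bracket
    refine neg_slope_le_of_bracket (hi := u') (R := D.Rbar) (fun j _ => (hD.pbar_mem s a).1 j)
      (hD.pbar_mem s a).2 (fun j _ => hbm a j) (fun j _ => ?_) (hθbm a) ?_ hε hεR h.nonneg h.le
      h.le_top ?_ hw
    · linarith [hD.target_le s a j, hbm0 a]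
    · linarith [hbm0 a]
    · rw [← slope_range (hq a) (hb a)]
      exact h.slope_right

/-- For κε ≥ AR both ends of the value bracket are set to the lower bound, so the search stops at
once; otherwise the bracket has width at most R. -/
lemma runs_stateValue (hD : D.Admissible) (hS : 0 < S) (hA : 0 < A) {s : Fin S} {ε : ℝ}
    (hε : 0 < ε) {σ : State} (h0 : σ.idx 0 = S) (h1 : σ.idx 1 = A) (hκ : σ.reg 1 = D.κ)
    (h2 : σ.reg 2 = ε) (h3 : σ.reg 3 = D.Rbar)
    (hq : ∀ (a : Fin A) (j : Fin S), σ.nominal a j = D.pbar s a j)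
    (hb : ∀ (a : Fin A) (j : Fin S), σ.target a j = D.target s a j) {M N : ℕ}
    (hM : D.κ * ε < A * D.Rbar → D.Rbar ≤ ε * 2 ^ M)
    (hN : 0 < M → 1 ≤ ε ^ 2 / (8 * D.Rbar ^ 2) * 2 ^ N) :
    Runs stateValue σ ((M * (N + 1) + 1) * (460 * (S * A))) fun τ =>
      Frame 3 4 σ τ ∧ |τ.reg 5 - D.bellman s| ≤ ε := by
  refine Runs.mono (Runs.seq (runs_maxMinTarget h0 h1 hS hA) (K₂ := 11 +
    (M * (N + 1) + 1) * (350 * (S * A))) ?_) ?_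
  · rintro τ ⟨h, hm0, hm, hm'⟩
    have hJm : τ.reg 4 ≤ D.bellman s := by
      rcases hm' with hm' | ⟨a, ha, hm'⟩
      · rw [hm']
        exact hD.le_bellman_of_le_target (a := ⟨0, hA⟩) fun j => hD.target_nonneg s _ j
      · exact hD.le_bellman_of_le_target (a := ⟨a, ha⟩) fun j => (hm' j j.2).trans (hb ⟨a, ha⟩ j).le
    have hJR := hD.bellman_le_Rbar hA s
    have key : Runs (.ite (.rlt (.mul (.var 1) (.var 2)) (.mul (.ofIdx (.var 1)) (.var 3)))
        (.rset 5 (.var 3)) (.rset 5 (.var 4))) τ 11 fun ρ => Frame 3 5 τ ρ ∧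
        ρ.reg 5 ≤ D.Rbar ∧ D.bellman s ≤ ρ.reg 5 + ε ∧ ρ.reg 5 - τ.reg 4 ≤ ε * 2 ^ M := by
      refine Runs.mono (K₁ := 11) (Runs.ite (K₁ := 2) (K₂ := 2)
        (fun hb' => Runs.rset ⟨Frame.refl.setReg, ?_⟩)
        (fun hb' => Runs.rset ⟨Frame.refl.setReg, ?_⟩)) le_rfl
      · simp only [BExp.holds, RExp.eval, IExp.eval, h.reg 1 (by omega), h.reg 2 (by omega),
          h.reg 3 (by omega), h.idx 1 (by omega), h1, h2, h3, hκ] at hb'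
        simp only [State.setReg, if_true, RExp.eval, h.reg 3 (by omega), h3]
        exact ⟨le_rfl, by linarith, by linarith [hM hb']⟩
      · simp only [BExp.holds, RExp.eval, IExp.eval, h.reg 1 (by omega), h.reg 2 (by omega),
          h.reg 3 (by omega), h.idx 1 (by omega), h1, h2, h3, hκ, not_lt] at hb'
        simp only [State.setReg, if_true, RExp.eval]
        refine ⟨hJm.trans hJR, hD.bellman_le_of_large_budget hA hε (fun a => ?_) hm0 hb', ?_⟩
        · obtain ⟨j, hj, hj'⟩ := hm a a.2
          exact ⟨⟨j, hj⟩, (hb a ⟨j, hj⟩) ▸ hj'⟩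
        · rw [sub_self]
          positivity
    refine Runs.seq key ?_
    rintro ρ ⟨k, k5, kJ, kM⟩
    have k4 : ρ.reg 4 = τ.reg 4 := k.reg 4 (by omega)
    have hk : Frame 3 4 σ ρ := h.trans k
    have r1 : ρ.reg 1 = D.κ := (hk.reg 1 (by omega)).trans hκ
    have r2 : ρ.reg 2 = ε := (hk.reg 2 (by omega)).trans h2
    have r3 : ρ.reg 3 = D.Rbar := (hk.reg 3 (by omega)).trans h3
    refine (runs_valueSearch (J := D.bellman s) ((hk.idx 0 (by omega)).trans h0)
      ((hk.idx 1 (by omega)).trans h1) hS hA (by rwa [r2]) (by rwa [k4]) (by rwa [r3])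
      (by rwa [r2, k4]) (by rwa [r2, r3]) (by rwa [k4]) (by rwa [r2]) ?_).imp ?_
    · rw [r1, r2, r3, k4, hk.nominal_eq, hk.target_eq]
      intro θ hθ1 hθ2 hεR bm u hd
      exact bellman_of_dualPoint hD hA hq hb hε hm hθ1 hθ2 hεR hd
    · rintro ν ⟨n1, n2⟩
      rw [r2] at n2
      exact ⟨hk.trans n1, n2⟩
  · have : 0 < S * A := Nat.mul_pos hS hA
    nlinarith [Nat.zero_le (M * (N + 1) * (S * A))]

lemma runs_bellmanUpdate (hD : D.Admissible) (hS : 0 < S) (hA : 0 < A) {ε : ℝ} (hε : 0 < ε)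
    {σ : State} (hσ : Holds σ D ε) {M N : ℕ} (hM : D.κ * ε < A * D.Rbar → D.Rbar ≤ ε * 2 ^ M)
    (hN : 0 < M → 1 ≤ ε ^ 2 / (8 * D.Rbar ^ 2) * 2 ^ N) :
    Runs bellmanUpdate σ ((M * (N + 1) + 1) * (600 * (S * (S * A)))) fun τ =>
      ∀ s : Fin S, |τ.arr 3 s 0 0 - D.bellman s| ≤ ε := by
  set B : ℝ := ⨆ i : Fin S × Fin A × Fin S, D.r i.1 i.2.1 i.2.2 with hB
  have hle : ∀ (s : Fin S) (a : Fin A) (j : Fin S), D.r s a j ≤ B := fun s a j =>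
    le_ciSup (f := fun i : Fin S × Fin A × Fin S => D.r i.1 i.2.1 i.2.2)
      (Set.finite_range _).bddAbove (s, a, j)
  refine Runs.mono (Runs.seq (runs_maxReward (B := B) hσ.size_S hσ.size_A hS hA
    (Real.iSup_nonneg fun i => hD.r_nonneg i.1 i.2.1 i.2.2) ?_) (K₂ := 7 +
      (S * (((M * (N + 1) + 1) * (460 * (S * A)) + 5) + 8) + 6)) ?_) ?_
  · intro s hs a ha j hj
    exact (hσ.r ⟨s, hs⟩ ⟨a, ha⟩ ⟨j, hj⟩).le.trans (hle _ _ _)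
  · rintro τ ⟨h, hub, hlb⟩
    have : Nonempty (Fin S × Fin A × Fin S) := ⟨(⟨0, hS⟩, ⟨0, hA⟩, ⟨0, hS⟩)⟩
    -- The loop keeps its register below the supremum and above every reward, which together give
    -- equality.
    have hmax : τ.reg 3 = B := hub.antisymm (ciSup_le fun i =>
      (hσ.r i.1 i.2.1 i.2.2).symm.le.trans (hlb _ i.1.2 _ i.2.1.2 _ i.2.2.2))
    have hR : (RExp.div (.var 3) (.sub (.ofIdx (.const 1)) (.var 0))).eval τ = D.Rbar := by
      simp only [RExp.eval, IExp.eval, Nat.cast_one, h.reg 0 (by omega), hσ.disc, hmax, Data.Rbar]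
      rw [div_eq_inv_mul]
    -- `Runs.for_frame` does not apply, as the body writes to the output array; the invariant
    -- instead fixes the arrays 0, 1, 2.
    refine Runs.mono (K₁ := 7 + _) (Runs.rset_seq (Runs.imp (Runs.for (x := 2) (y := 0) (N := S)
      (K := (M * (N + 1) + 1) * (460 * (S * A)) + 5) (fun i ρ => ρ.idx 1 = A ∧
        ρ.reg 0 = D.disc ∧ ρ.reg 1 = D.κ ∧ ρ.reg 2 = ε ∧ ρ.reg 3 = D.Rbar ∧
        (∀ n < 3, ρ.arr n = σ.arr n) ∧ ∀ s : Fin S, s < i → |ρ.arr 3 s 0 0 - D.bellman s| ≤ ε)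
      (by norm_num) ?_ ?_ ?_) ?_)) le_rfl
    · exact (h.idx 0 (by omega)).trans hσ.size_S
    · rw [hR]
      refine ⟨?_, ?_, ?_, ?_, ?_, ?_, ?_⟩
      · simpa [State.setIdx, State.setReg] using (h.idx 1 (by omega)).trans hσ.size_A
      · simpa [State.setIdx, State.setReg] using (h.reg 0 (by omega)).trans hσ.disc
      · simpa [State.setIdx, State.setReg] using (h.reg 1 (by omega)).trans hσ.κ
      · simpa [State.setIdx, State.setReg] using (h.reg 2 (by omega)).trans hσ.ε
      · simp [State.setIdx, State.setReg]
      · exact fun n _ => congrFun h.arr n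
      · simp
    · rintro i hi ρ hρ hρ0 ⟨p1, pd, pκ, pε, pR, parr, pout⟩
      refine Runs.seq (runs_stateValue hD hS hA (s := ⟨i, hi⟩) hε hρ0 p1 pκ pε pR ?_ ?_ hM hN) ?_
      · intro a j
        simp only [State.nominal, parr 0 (by omega), hρ]
        exact hσ.pbar ⟨i, hi⟩ a j
      · intro a j
        simp only [State.target, parr 1 (by omega), parr 2 (by omega), hρ, pd, hσ.v]
        rw [← hσ.r ⟨i, hi⟩ a j |>.symm]
        rfl
      · rintro ν ⟨k, kval⟩
        refine Runs.aset ?_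
        have i2 : ν.idx 2 = i := (k.idx 2 (by omega)).trans hρ
        refine ⟨i2, (k.idx 0 (by omega)).trans hρ0, ?_, (k.reg 0 (by omega)).trans pd,
          (k.reg 1 (by omega)).trans pκ, (k.reg 2 (by omega)).trans pε,
          (k.reg 3 (by omega)).trans pR, ?_, ?_⟩
        · simpa [State.setIdx, State.setArr] using (k.idx 1 (by omega)).trans p1
        · intro n hn
          rw [← parr n hn, ← k.arr]
          funext i' j' k'
          simp only [State.setIdx, State.setArr]
          rw [if_neg (by omega)]
        · intro s hs
          simp only [State.setIdx, State.setArr, IExp.eval, RExp.eval, i2, true_and, and_true]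
          split_ifs with hsi
          · have : s = ⟨i, hi⟩ := Fin.ext hsi
            rwa [this]
          · rw [k.arr]
            exact pout s (by omega)
    · exact fun ρ hρ s => hρ.2.2.2.2.2.2 s s.2
  · have h1 : 0 < S * A := Nat.mul_pos hS hA
    have h2 : S ≤ S * (S * A) := Nat.le_mul_of_pos_right S h1
    nlinarith [Nat.zero_le (M * (N + 1) * (S * (S * A)))]

end Program

/-! ### The number of iterations -/

lemma le_two_pow_ceil {y : ℝ} (hy : 0 < y) : y ≤ 2 ^ ⌈Real.log y / Real.log 2⌉₊ := by
  have h2 : 0 < Real.log 2 := Real.log_pos one_lt_two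
  rw [← Real.log_le_log_iff hy (by positivity), Real.log_pow, ← div_le_iff₀ h2]
  exact Nat.le_ceil _

lemma one_le_logFactor (x : ℝ) : 1 ≤ logFactor x := le_max_left _ _

lemma log_le_logFactor (x : ℝ) : Real.log x ≤ logFactor x := le_max_right _ _

/-- The hypothesis gives x ≤ a · x²/κ. Take logarithms and bound the sum of two numbers that are at
least 1 by twice their product. -/
lemma logFactor_le_of_lt_mul {x κ a : ℝ} (hx : 1 < x) (hκ : 0 < κ) (ha : 0 < a) (h : κ < a * x) :
    logFactor x ≤ 2 * (logFactor a * logFactor (x ^ 2 / κ)) := by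
  have h1 := one_le_logFactor a
  have h2 := one_le_logFactor (x ^ 2 / κ)
  have h3 : Real.log x ≤ Real.log a + Real.log (x ^ 2 / κ) := by
    rw [← Real.log_mul ha.ne' (by positivity)]
    apply Real.log_le_log (by linarith)
    rw [← mul_div_assoc, le_div_iff₀ hκ]
    nlinarith
  have h4 := log_le_logFactor a
  have h5 := log_le_logFactor (x ^ 2 / κ)
  exact max_le (by nlinarith) (by nlinarith)

/-- M and N are the outer and inner iteration counts. Only the inner logarithm is exchanged for the
product P of the other two factors. With x = R/ε this gives M ≤ 3 ℓ(x) and N + 1 ≤ 16 P, hence 49 =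
3 · 16 + 1. -/
lemma exists_iteration_counts {R ε κ a : ℝ} (hε : 0 < ε) (hκ : 0 < κ)
    (ha : 0 < a) : ∃ M N : ℕ, (κ * ε < a * R → R ≤ ε * 2 ^ M) ∧
      (0 < M → 1 ≤ ε ^ 2 / (8 * R ^ 2) * 2 ^ N) ∧
      ((M * (N + 1) + 1 : ℕ) : ℝ) ≤
        49 * (logFactor a * logFactor (R ^ 2 / (ε ^ 2 * κ)) * logFactor (R / ε)) := by
  have h1 := one_le_logFactor a
  have h2 := one_le_logFactor (R ^ 2 / (ε ^ 2 * κ))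
  have h3 := one_le_logFactor (R / ε)
  have h12 := one_le_mul_of_one_le_of_one_le h1 h2
  have h123 := one_le_mul_of_one_le_of_one_le h12 h3
  by_cases hc : κ * ε < a * R ∧ ε < R
  · obtain ⟨hc1, hc2⟩ := hc
    have hR0 : 0 < R := hε.trans hc2
    set x := R / ε with hx
    have hx1 : 1 < x := by rwa [hx, one_lt_div hε]
    have hx0 : 0 < x := by linarith
    have hRx : R = ε * x := by rw [hx]; field_simp
    have hx2 : R ^ 2 / (ε ^ 2 * κ) = x ^ 2 / κ := by rw [hRx]; field_simp
    have hl2 : 0.6931471803 < Real.log 2 := Real.log_two_gt_d9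
    have hlx : 0 < Real.log x := Real.log_pos hx1
    have hℓ := log_le_logFactor x
    -- 1/log 2 is about 1.443, hence below 3/2.
    have hdiv : Real.log x / Real.log 2 ≤ 3 / 2 * Real.log x := by
      rw [div_le_iff₀ (by linarith)]
      nlinarith
    have hlog8 : Real.log (8 * x ^ 2) / Real.log 2 = 3 + 2 * (Real.log x / Real.log 2) := by
      rw [Real.log_mul (by norm_num) (by positivity), Real.log_pow,
        show (8 : ℝ) = 2 ^ 3 by norm_num, Real.log_pow]
      field_simp
      push_cast
      ring
    refine ⟨⌈Real.log x / Real.log 2⌉₊, ⌈Real.log (8 * x ^ 2) / Real.log 2⌉₊, fun _ => ?_,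
      fun _ => ?_, ?_⟩
    · calc R = ε * x := hRx
        _ ≤ _ := mul_le_mul_of_nonneg_left (le_two_pow_ceil hx0) hε.le
    · have := le_two_pow_ceil (y := 8 * x ^ 2) (by positivity)
      have e : ε ^ 2 / (8 * R ^ 2) = (8 * x ^ 2)⁻¹ := by rw [hRx]; field_simp
      rw [e, ← div_eq_inv_mul, le_div_iff₀ (by positivity), one_mul]
      exact this
    · have hM := (Nat.ceil_lt_add_one (a := Real.log x / Real.log 2)
        (div_nonneg hlx.le (by linarith))).le
      have hN := (Nat.ceil_lt_add_one (a := Real.log (8 * x ^ 2) / Real.log 2)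
        (by rw [hlog8]; have := div_nonneg hlx.le (by linarith : 0 ≤ Real.log 2); linarith)).le
      rw [hlog8] at hN ⊢
      have hκx : κ < a * x := by
        rw [hx, ← mul_div_assoc, lt_div_iff₀ hε]
        exact hc1
      have hcmp := logFactor_le_of_lt_mul hx1 hκ ha hκx
      rw [hx2] at h12 h123 ⊢
      push_cast
      set P := logFactor a * logFactor (x ^ 2 / κ)
      set m : ℝ := (⌈Real.log x / Real.log 2⌉₊ : ℝ)
      set n : ℝ := (⌈3 + 2 * (Real.log x / Real.log 2)⌉₊ : ℝ)
      have hm : m ≤ 3 * logFactor x := by linarith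
      have hn : n + 1 ≤ 16 * P := by linarith
      have hn0 : 0 ≤ n := Nat.cast_nonneg _
      have := mul_le_mul hm hn (by linarith) (by linarith)
      linarith
  -- Either the budget is large or R ≤ ε; no iteration is needed in either case.
  · refine ⟨0, 0, fun h => ?_, by simp, ?_⟩
    · simpa using not_lt.1 fun h' => hc ⟨h, h'⟩
    · simp only [zero_mul, zero_add, Nat.cast_one]
      linarith

end BurgRMDP

theorem mainTheorem8 :
    ∃ (prog : BurgRMDP.Cmd) (C : ℝ), 0 < C ∧
      ∀ (S A : ℕ), 0 < S → 0 < A →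
      ∀ (D : BurgRMDP.Data S A), D.Admissible →
      ∀ (ε : ℝ), 0 < ε →
      ∀ (σ : BurgRMDP.State), BurgRMDP.Holds σ D ε →
        ∃ (τ : BurgRMDP.State) (t : ℕ), BurgRMDP.Exec prog σ τ t ∧
          ‖τ.output S - D.bellman‖ ≤ ε ∧
          (t : ℝ) ≤ C * ((S : ℝ) ^ 2 * ((A : ℝ) * BurgRMDP.logFactor A)
            * BurgRMDP.logFactor (D.Rbar ^ 2 / (ε ^ 2 * D.κ))
            * BurgRMDP.logFactor (D.Rbar / ε)) := by
  -- 29400 = 49 · 600, the iteration constant times the cost constant of `runs_bellmanUpdate`.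
  refine ⟨BurgRMDP.Program.bellmanUpdate, 29400, by norm_num, ?_⟩
  intro S A hS hA D hD ε hε σ hσ
  obtain ⟨M, N, hM, hN, hMN⟩ := BurgRMDP.exists_iteration_counts (R := D.Rbar) (a := A) hε hD.κ_pos
    (by exact_mod_cast hA)
  obtain ⟨τ, t, hexec, ht, hout⟩ :=
    BurgRMDP.Program.runs_bellmanUpdate hD hS hA hε hσ hM hN
  refine ⟨τ, t, hexec, (pi_norm_le_iff_of_nonneg hε.le).2 fun s => ?_, ?_⟩
  · exact hout s
  · calc (t : ℝ) ≤ (((M * (N + 1) + 1) * (600 * (S * (S * A))) : ℕ) : ℝ) := by exact_mod_cast ht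
      _ = ((M * (N + 1) + 1 : ℕ) : ℝ) * (600 * (S * (S * A))) := by push_cast; ring
      _ ≤ 49 * (BurgRMDP.logFactor A * BurgRMDP.logFactor (D.Rbar ^ 2 / (ε ^ 2 * D.κ)) *
            BurgRMDP.logFactor (D.Rbar / ε)) * (600 * (S * (S * A))) :=
          mul_le_mul_of_nonneg_right hMN (by positivity)
      _ = _ := by ring
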